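/- Conventions. A quiver $Q=(Q_0,Q_1,s,r)$ is a directed graph; it is row-finite if every vertex emits only finitely many arrows. $T(u)$ is the set of vertices that can be reached from $u$ by a (possibly trivial) path. A vertex $u$ is a line point if no $w\in T(u)$ emits two or more arrows or has a cycle based at it; $P_l(Q)$ is the set of line points. A set $H\subseteq Q_0$ is hereditary if $r(e)\in H$ whenever $s(e)\in H$, and saturated if it contains each vertex $v$ that emits at least one and only finitely many arrows, all with range in $H$; $\overline{S}$ is the smallest hereditary saturated set containing $S$, and $Q\setminus H$ is the quiver of the vertices outside $H$ and the arrows between them. Put $P_l^1(Q)=P_l(Q)$, $P_l^{\alpha+1}(Q)=P_l^\alpha(Q)\cup P_l\bigl(Q\setminus\overline{P_l^\alpha(Q)}\bigr)$ for each ordinal $\alpha\ge 1$, $P_l^\beta(Q)=\bigcup_{1\le\alpha<\beta}P_l^\alpha(Q)$ for limit ordinals $\beta$, and $\overrightarrow{P_l}(Q)=\bigcup_\alpha P_l^\alpha(Q)$. For an algebra $A$, $\mathrm{Soc}(A)$ is the (left) socle, i.e. the sum of the minimal left ideals; $\mathrm{Soc}^1(A)=\mathrm{Soc}(A)$, $\mathrm{Soc}^{\alpha+1}(A)/\mathrm{Soc}^\alpha(A)=\mathrm{Soc}(A/\mathrm{Soc}^\alpha(A))$,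 $\mathrm{Soc}^\beta(A)=\sum_{1\le\alpha<\beta}\mathrm{Soc}^\alpha(A)$ for limit ordinals $\beta$, and $\overrightarrow{\mathrm{Soc}}(A)=\sum_\alpha\mathrm{Soc}^\alpha(A)$. $L_{\mathbb K}(Q)$ is the Leavitt path algebra of $Q$ over a field $\mathbb K$. Statement. Let $Q$ be a row-finite quiver, let $\mathbb K$ be a field, and put $H=\overline{P_l(Q)}$. (1) If $u\in P_l(Q\setminus H)$, then there is an arrow $f$ with $s(f)=u$, $r(f)\notin H$ and $r(f)\neq u$. (2) More generally, let $k\ge 1$ and let $u_1,\dots,u_k$ be pairwise different vertices outside $H$ such that for each $1\le i\le k-1$ there is an arrow from $u_i$ to $u_{i+1}$, and $u_1\in P_l(Q\setminus H)$. Then there is a vertex $u_{k+1}\notin\{u_1,\dots,u_k\}$ with $u_{k+1}\notin H$ and an arrow from $u_k$ to $u_{k+1}$. (3) If $Q_0$ is finite, then $P_l(Q\setminus H)=\emptyset$, $\overrightarrow{P_l}(Q)=P_l^1(Q)$, $\mathrm{Soc}^2(L_{\mathbb K}(Q))=\mathrm{Soc}^1(L_{\mathbb K}(Q))$ and $\overrightarrow{\mathrm{Soc}}(L_{\mathbb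 K}(Q))=\mathrm{Soc}^1(L_{\mathbb K}(Q))$. -/

import Mathlib

/-!
Quivers are Mathlib quivers: a type of vertices `V` with a type `a ⟶ b` of arrows for each pair
of vertices. `Quiver.Total V` is the type of all arrows, `Quiver.Star v` the type of the arrows
with source `v`.
-/

namespace LeavittQuiver

universe u v w

/-! ### Row-finite quivers, line points, hereditary saturated closures -/

section Combinatorics

variable (V : Type u) [Quiver.{v} V]

/-- Every vertex emits only finitely many arrows. -/
def RowFinite : Prop := ∀ a : V, Finite (Quiver.Star a)

variable {V}

/-- A vertex is regular if it emits at least one and only finitely many arrows. -/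
def IsRegularVertex (a : V) : Prop := Nonempty (Quiver.Star a) ∧ Finite (Quiver.Star a)

/-- A vertex is a bifurcation if it emits at least two arrows. -/
def IsBifurcation (a : V) : Prop := Nontrivial (Quiver.Star a)

/-- The tree `T(a)`: all vertices `b` such that there is a path (possibly trivial) from `a`
to `b`. -/
def tree (a : V) : Set V := {b | Nonempty (Quiver.Path a b)}

/-- A closed path `e₁ ⋯ eₙ` (`n ≥ 1`) is a cycle if the sources of `e₁, …, eₙ` are pairwise
different. The sources are all the vertices of the path except the last one. -/
def IsCycle {a : V} (p : Quiver.Path a a) : Prop :=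
  0 < p.length ∧ p.vertices.dropLast.Nodup

/-- There is a cycle at the vertex `a`. -/
def HasCycleAt (a : V) : Prop := ∃ p : Quiver.Path a a, IsCycle p

/-- A line point: there are neither bifurcations nor cycles at any vertex of its tree. -/
def IsLinePoint (a : V) : Prop := ∀ b ∈ tree a, ¬ IsBifurcation b ∧ ¬ HasCycleAt b

variable (V) in
/-- The set `P_l(Q)` of line points. -/
def linePoints : Set V := {a | IsLinePoint a}

/-- `H` is hereditary: ranges of arrows that start in `H` are in `H`. -/
def IsHereditary (H : Set V) : Prop := ∀ a ∈ H, ∀ b : V, (a ⟶ b) → b ∈ H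

/-- `H` is saturated: a regular vertex all of whose arrows end in `H` is in `H`. -/
def IsSaturated (H : Set V) : Prop :=
  ∀ a : V, IsRegularVertex a → (∀ b : V, (a ⟶ b) → b ∈ H) → a ∈ H

/-- The hereditary saturated closure: the smallest hereditary and saturated set that
contains `S`. -/
def hsClosure (S : Set V) : Set V := ⋂₀ {H | S ⊆ H ∧ IsHereditary H ∧ IsSaturated H}

/-- The vertex type of the quiver `Q ∖ H`. -/
def Remove (H : Set V) : Type u := {a : V // a ∉ H}

/-- The quiver `Q ∖ H`: the vertices outside `H`, and all arrows of `Q` between them. -/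
instance (H : Set V) : Quiver.{v} (Remove H) := ⟨fun a b => (a.1 ⟶ b.1)⟩

/-- The set `P_l(Q ∖ H)`, as a set of vertices of `Q`. -/
def linePointsOff (H : Set V) : Set V :=
  (fun a : Remove H => a.1) '' linePoints (Remove H)

end Combinatorics

section LinePointSeries

variable (V : Type u) [Quiver.{v} V]

open Classical in
/-- The sets `P_l^α(Q)` for ordinals `α ≥ 1`: `P_l^1(Q) = P_l(Q)`, the successor step adds
the line points of the quiver without the hereditary saturated closure of what is already there,
and at limit ordinals one takes the union. The indexing of the sequence starts at `1`;
the value at `0` is the empty set. -/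
noncomputable def linePointSeries (α : Ordinal.{u}) : Set V :=
  Ordinal.limitRecOn α ∅
    (fun α S => if α = 0 then linePoints V else S ∪ linePointsOff (hsClosure S))
    (fun β _ S => ⋃ (α : Ordinal.{u}) (h : α < β), S α h)

/-- The union of the sets `P_l^α(Q)` over all ordinals `α`. -/
noncomputable def linePointUnion : Set V := ⋃ α : Ordinal.{u}, linePointSeries V α

end LinePointSeries

/-! ### The socle of a (not necessarily unital) ring and its Loewy series -/

section Socle

/-- An additive subgroup that absorbs multiplication from the left. -/
def IsLeftIdeal {A : Type w} [NonUnitalRing A] (M : AddSubgroup A) : Prop :=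
  ∀ a : A, ∀ x ∈ M, a * x ∈ M

/-- A left ideal that is minimal among the nonzero left ideals. -/
def IsMinimalLeftIdeal {A : Type w} [NonUnitalRing A] (M : AddSubgroup A) : Prop :=
  Minimal (fun N : AddSubgroup A => IsLeftIdeal N ∧ N ≠ ⊥) M

variable (A : Type w) [NonUnitalRing A]

/-- The sum of all minimal left ideals, as an additive subgroup. -/
def socleAddSubgroup : AddSubgroup A := sSup {M | IsMinimalLeftIdeal M}

variable {A}

theorem mul_mem_left_socle (a x : A) (hx : x ∈ socleAddSubgroup A) :
    a * x ∈ socleAddSubgroup A := by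
  have h : socleAddSubgroup A ≤ (socleAddSubgroup A).comap (AddMonoidHom.mulLeft a) :=
    sSup_le fun M hM y hy => le_sSup (a := M) hM (hM.1.1 a y hy)
  exact h hx

theorem mul_mem_right_socle (x a : A) (hx : x ∈ socleAddSubgroup A) :
    x * a ∈ socleAddSubgroup A := by
  have h : socleAddSubgroup A ≤ (socleAddSubgroup A).comap (AddMonoidHom.mulRight a) := by
    refine sSup_le fun M hM => ?_
    rw [← AddSubgroup.map_le_iff_le_comap]
    by_cases h0 : M.map (AddMonoidHom.mulRight a) = ⊥
    · rw [h0]; exact bot_le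
    · refine le_sSup (a := M.map (AddMonoidHom.mulRight a)) ⟨⟨?_, h0⟩, ?_⟩
      · rintro b _ ⟨y, hy, rfl⟩
        exact ⟨b * y, hM.1.1 b y hy, by simp [mul_assoc]⟩
      · rintro N ⟨hN, hN0⟩ hle
        have key : M ≤ M ⊓ N.comap (AddMonoidHom.mulRight a) := by
          refine hM.2 ⟨?_, ?_⟩ inf_le_left
          · rintro b y ⟨hy, hy'⟩
            refine ⟨hM.1.1 b y hy, ?_⟩
            have := hN b _ hy'
            simpa [mul_assoc] using this
          · intro hbot
            apply hN0
            rw [eq_bot_iff]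
            intro z hz
            obtain ⟨y, hy, rfl⟩ := hle hz
            have hy0 : y ∈ M ⊓ N.comap (AddMonoidHom.mulRight a) := ⟨hy, hz⟩
            rw [hbot, AddSubgroup.mem_bot] at hy0
            simp [hy0]
        rintro _ ⟨y, hy, rfl⟩
        exact (key hy).2
  exact h hx

variable (A) in
/-- The (left) socle `Soc(A)`: the two-sided ideal that is the sum of all minimal left ideals
of `A`. -/
def socle : TwoSidedIdeal A :=
  TwoSidedIdeal.mk' (socleAddSubgroup A : Set A) (zero_mem _) (fun h h' => add_mem h h')
    (fun h => neg_mem h) (fun h => mul_mem_left_socle _ _ h) (fun h => mul_mem_right_socle _ _ h)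

/-- The quotient map from `A` to `A / I`. -/
def quotientMap (I : TwoSidedIdeal A) : A →ₙ+* I.ringCon.Quotient where
  toFun x := x
  map_mul' _ _ := rfl
  map_zero' := rfl
  map_add' _ _ := rfl

/-- The ideal `J` of `A` that contains `I` and satisfies `J / I = Soc(A / I)`. -/
def socleOver (I : TwoSidedIdeal A) : TwoSidedIdeal A :=
  TwoSidedIdeal.comap (quotientMap I) (socle I.ringCon.Quotient)

variable (A)

open Classical in
/-- The Loewy series of socles `Soc^α(A)` for ordinals `α ≥ 1`: `Soc^1(A) = Soc(A)`,
`Soc^(α+1)(A) / Soc^α(A) = Soc(A / Soc^α(A))`, and sums at limit ordinals. The indexing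
starts at `1`; the value at `0` is the zero ideal. -/
noncomputable def socleSeries (α : Ordinal.{w}) : TwoSidedIdeal A :=
  Ordinal.limitRecOn α ⊥
    (fun α I => if α = 0 then socle A else socleOver I)
    (fun β _ I => ⨆ (α : Ordinal.{w}) (h : α < β), I α h)

/-- The sum of the ideals `Soc^α(A)` over all ordinals `α`. -/
noncomputable def socleSum : TwoSidedIdeal A := ⨆ α : Ordinal.{w}, socleSeries A α

end Socle

/-! ### Leavitt path algebras -/

section Leavitt

variable (K : Type w) [Field K] (V : Type u) [Quiver.{v} V]

/-- The generators: vertices, arrows and ghost arrows. -/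
inductive Gen : Type (max u v)
  | vertex (a : V) : Gen
  | arrow (e : Quiver.Total V) : Gen
  | ghost (e : Quiver.Total V) : Gen

/-- The free associative (non-unital) `K`-algebra on the generators: its `K`-basis consists of
the nonempty words in the generators. -/
abbrev FreeAlg : Type (max u v w) := MonoidAlgebra K (FreeSemigroup (Gen V))

variable {V}

/-- The vertex `a` in the free algebra. -/
noncomputable def fVertex (a : V) : FreeAlg K V :=
  MonoidAlgebra.single (FreeSemigroup.of (Gen.vertex a)) 1

/-- The arrow `e` in the free algebra. -/
noncomputable def fArrow (e : Quiver.Total V) : FreeAlg K V :=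
  MonoidAlgebra.single (FreeSemigroup.of (Gen.arrow e)) 1

/-- The ghost arrow `e*` in the free algebra. -/
noncomputable def fGhost (e : Quiver.Total V) : FreeAlg K V :=
  MonoidAlgebra.single (FreeSemigroup.of (Gen.ghost e)) 1

/-- The arrow with source `a` that belongs to an element of the star of `a`. -/
def starArrow {a : V} (p : Quiver.Star a) : Quiver.Total V := ⟨a, p.1, p.2⟩

variable (V)

/-- The defining relations of the Leavitt path algebra. -/
inductive Rel : FreeAlg K V → FreeAlg K V → Prop
  | vertex_mul_self (a : V) : Rel (fVertex K a * fVertex K a) (fVertex K a)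
  | vertex_mul_ne (a b : V) (h : a ≠ b) : Rel (fVertex K a * fVertex K b) 0
  | source_arrow (e : Quiver.Total V) : Rel (fVertex K e.left * fArrow K e) (fArrow K e)
  | arrow_range (e : Quiver.Total V) : Rel (fArrow K e * fVertex K e.right) (fArrow K e)
  | range_ghost (e : Quiver.Total V) : Rel (fVertex K e.right * fGhost K e) (fGhost K e)
  | ghost_source (e : Quiver.Total V) : Rel (fGhost K e * fVertex K e.left) (fGhost K e)
  | ck1_self (e : Quiver.Total V) : Rel (fGhost K e * fArrow K e) (fVertex K e.right)
  | ck1_ne (e f : Quiver.Total V) (h : e ≠ f) : Rel (fGhost K e * fArrow K f) 0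
  | ck2 (a : V) (_ : Nonempty (Quiver.Star a)) (_ : Fintype (Quiver.Star a)) :
      Rel (fVertex K a)
        (∑ p : Quiver.Star a, fArrow K (starArrow p) * fGhost K (starArrow p))

/-- All scalar multiples of the defining relations. The ring congruence that they generate is
the smallest congruence of `K`-algebras that contains the defining relations. -/
def ScaledRel (x y : FreeAlg K V) : Prop :=
  ∃ (k : K) (x' y' : FreeAlg K V), Rel K V x' y' ∧ x = k • x' ∧ y = k • y'

/-- The congruence of `K`-algebras generated by the defining relations. -/
noncomputable def leavittCon : RingCon (FreeAlg K V) := ringConGen (ScaledRel K V)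

/-- The Leavitt path algebra `L_K(Q)`. -/
def LeavittPathAlgebra : Type (max u v w) := (leavittCon K V).Quotient

noncomputable instance : NonUnitalRing (LeavittPathAlgebra K V) :=
  inferInstanceAs (NonUnitalRing (leavittCon K V).Quotient)

theorem leavittCon_smul (k : K) {x y : FreeAlg K V} (h : leavittCon K V x y) :
    leavittCon K V (k • x) (k • y) := by
  change RingConGen.Rel (ScaledRel K V) x y at h
  change RingConGen.Rel (ScaledRel K V) (k • x) (k • y)
  induction h with
  | of x y h =>
    obtain ⟨l, x', y', h, rfl, rfl⟩ := h
    exact .of _ _ ⟨k * l, x', y', h, smul_smul _ _ _, smul_smul _ _ _⟩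
  | refl x => exact .refl _
  | symm _ ih => exact ih.symm
  | trans _ _ ih ih' => exact ih.trans ih'
  | add _ _ ih ih' => simpa only [smul_add] using ih.add ih'
  | mul _ h' ih _ => simpa only [smul_mul_assoc] using ih.mul h'

noncomputable instance : SMul K (LeavittPathAlgebra K V) :=
  ⟨fun k => Quotient.map' (fun x => k • x) fun _ _ h => leavittCon_smul K V k h⟩

/-- The quotient map from the free algebra. -/
noncomputable def toLeavitt : FreeAlg K V →+ LeavittPathAlgebra K V where
  toFun x := RingCon.toQuotient (c := leavittCon K V) x
  map_zero' := rfl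
  map_add' _ _ := rfl

theorem toLeavitt_surjective : Function.Surjective (toLeavitt K V) :=
  Quotient.mk''_surjective

noncomputable instance : Module K (LeavittPathAlgebra K V) :=
  (toLeavitt_surjective K V).module K (toLeavitt K V) fun _ _ => rfl

instance : IsScalarTower K (LeavittPathAlgebra K V) (LeavittPathAlgebra K V) where
  smul_assoc k x y := by
    obtain ⟨x, rfl⟩ := toLeavitt_surjective K V x
    obtain ⟨y, rfl⟩ := toLeavitt_surjective K V y
    exact congrArg (toLeavitt K V) (smul_mul_assoc k x y)

instance : SMulCommClass K (LeavittPathAlgebra K V) (LeavittPathAlgebra K V) where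
  smul_comm k x y := by
    obtain ⟨x, rfl⟩ := toLeavitt_surjective K V x
    obtain ⟨y, rfl⟩ := toLeavitt_surjective K V y
    exact congrArg (toLeavitt K V) (mul_smul_comm k x y).symm

end Leavitt

end LeavittQuiver

/-!
A line point of `Q \ H` reaches no cycle, so the vertices of a path that starts at it are pairwise
different. On the other hand `Q \ H` has no sinks: a sink of `Q` is a line point, and a vertex all
of whose arrows end in `H` lies in `H` by saturation. This proves (1) and (2), and it shows that a
line point of `Q \ H` starts an infinite path without repeated vertices.

Suppose that every infinite path of `Q` repeats a vertex, and let `I` be an ideal that contains all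
sinks and acts as zero on the module spanned by the infinite paths. Then `L / I` has socle zero.
Otherwise let `b` span a minimal left ideal modulo `I`. Multiplying `b` by a long path on the right
removes the ghost arrows, and by (CK1) a further multiplication on the left turns it into
`q = a + (paths of positive length)` for some vertex `a`. Conjugation by arrows moves `a` along an
infinite path until it reaches a closed path `c`, say based at `a`. But then the left ideal of
`(a - c) q` is smaller than that of `q`, yet nonzero modulo `I`. Taking for `I` the annihilator of
the module shows that the socle of `L` acts as zero; the socle contains the sinks, so it can be
taken for `I` itself.
-/

namespace LeavittQuiver

universe u v w

section LinePoints

variable {V : Type u} [Quiver.{v} V]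

theorem nodup_vertices_or_exists_hasCycleAt {a b : V} (p : Quiver.Path a b) :
    p.vertices.Nodup ∨ ∃ c ∈ tree a, HasCycleAt c := by
  induction p with
  | nil => exact .inl (List.nodup_singleton a)
  | @cons b c p e ih =>
    refine ih.elim (fun hp => ?_) .inr
    by_cases hc : c ∈ p.vertices
    · obtain ⟨p₁, p₂, rfl⟩ := p.exists_eq_comp_of_mem_vertices hc
      rw [Quiver.Path.vertices_comp] at hp
      refine .inr ⟨c, ⟨p₁⟩, p₂.cons e, Nat.succ_pos _, ?_⟩
      rw [Quiver.Path.vertices_cons, List.concat_eq_append, List.dropLast_concat]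
      exact hp.of_append_right
    · rw [Quiver.Path.vertices_cons]
      exact .inl (hp.concat hc)

theorem IsLinePoint.nodup_vertices {a b : V} (ha : IsLinePoint a) (p : Quiver.Path a b) :
    p.vertices.Nodup :=
  (nodup_vertices_or_exists_hasCycleAt p).resolve_right fun ⟨c, hc, hcyc⟩ => (ha c hc).2 hcyc

theorem IsLinePoint.isEmpty_hom {a b c : V} (ha : IsLinePoint a) (hb : b ∈ tree a)
    (hc : c ∈ tree b) : IsEmpty (c ⟶ b) := by
  obtain ⟨⟨p⟩, ⟨q⟩⟩ := And.intro hb hc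
  refine ⟨fun e => ?_⟩
  have hnodup := ha.nodup_vertices (p.comp (q.cons e))
  rw [Quiver.Path.vertices_comp, Quiver.Path.vertices_cons] at hnodup
  exact (List.nodup_concat _ _).1 hnodup.of_append_right |>.1 q.start_mem_vertices

theorem mem_tree_of_seq {f : ℕ → V} (h : ∀ n, Nonempty (f n ⟶ f (n + 1))) {i j : ℕ}
    (hij : i ≤ j) : f j ∈ tree (f i) := by
  induction j, hij using Nat.le_induction with
  | base => exact ⟨.nil⟩
  | succ j _ ih => exact ih.map2 Quiver.Path.cons (h j)

theorem IsLinePoint.injective_of_seq {f : ℕ → V} (h0 : IsLinePoint (f 0))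
    (h : ∀ n, Nonempty (f n ⟶ f (n + 1))) : Function.Injective f := by
  refine .of_lt_imp_ne fun i j hij heq => ?_
  obtain ⟨j, rfl⟩ := Nat.exists_eq_succ_of_ne_zero (Nat.ne_zero_of_lt hij)
  have := h0.isEmpty_hom (mem_tree_of_seq h i.zero_le) (mem_tree_of_seq h (Nat.le_of_lt_succ hij))
  rw [heq] at this
  exact not_nonempty_iff.2 this (h j)

theorem exists_seq_of_forall_exists_hom (h : ∀ a : V, ∃ b, Nonempty (a ⟶ b)) (a : V) :
    ∃ f : ℕ → V, f 0 = a ∧ ∀ n, Nonempty (f n ⟶ f (n + 1)) := by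
  choose g hg using h
  refine ⟨fun n => g^[n] a, rfl, fun n => ?_⟩
  simpa only [Function.iterate_succ_apply'] using hg (g^[n] a)

variable (V) in
/-- A quiver is rayless if no infinite path in it visits pairwise different vertices. This is the
finiteness condition under which the series of line points and of socles stabilise at once. -/
def Rayless : Prop := ∀ f : ℕ → V, (∀ n, Nonempty (f n ⟶ f (n + 1))) → ¬ Function.Injective f

theorem rayless_of_finite [Finite V] : Rayless V := fun f _ => not_injective_infinite_finite f

theorem Rayless.remove (hV : Rayless V) (H : Set V) : Rayless (Remove H) :=
  fun f hf hinj => hV (fun n => (f n).1) hf (Subtype.val_injective.comp hinj)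

theorem Rayless.linePoints_eq_empty (hV : Rayless V) (h : ∀ a : V, ∃ b, Nonempty (a ⟶ b)) :
    linePoints V = ∅ := by
  refine Set.eq_empty_of_forall_notMem fun a ha => ?_
  obtain ⟨f, rfl, hf⟩ := exists_seq_of_forall_exists_hom h a
  exact hV f hf (ha.injective_of_seq hf)

theorem IsLinePoint.exists_hom_notMem_range (h : ∀ a : V, ∃ b, Nonempty (a ⟶ b)) {k : ℕ}
    {u : Fin (k + 1) → V} (h0 : IsLinePoint (u 0))
    (hu : ∀ i : Fin k, Nonempty (u i.castSucc ⟶ u i.succ)) :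
    ∃ b ∉ Set.range u, Nonempty (u (Fin.last k) ⟶ b) := by
  have from_start (i) : u i ∈ tree (u 0) := by
    induction i using Fin.induction with
    | zero => exact ⟨.nil⟩
    | succ i ih => exact ih.map2 Quiver.Path.cons (hu i)
  have to_end (i) : u (Fin.last k) ∈ tree (u i) := by
    induction i using Fin.reverseInduction with
    | last => exact ⟨.nil⟩
    | cast i ih => exact (hu i).map2 (fun e => e.toPath.comp) ih
  obtain ⟨b, ⟨e⟩⟩ := h (u (Fin.last k))
  refine ⟨b, ?_, ⟨e⟩⟩
  rintro ⟨i, rfl⟩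
  exact (h0.isEmpty_hom (from_start i) (to_end i)).false e

theorem isLinePoint_of_isEmpty_star {a : V} [h : IsEmpty (Quiver.Star a)] : IsLinePoint a := by
  have length_eq_zero {b : V} (p : Quiver.Path a b) : p.length = 0 := by
    by_contra hp
    obtain ⟨c, e, -⟩ := p.length_ne_zero_iff_eq_comp.1 hp
    exact h.false ⟨c, e⟩
  rintro b ⟨p⟩
  obtain rfl := p.eq_of_length_zero (length_eq_zero p)
  refine ⟨fun hb => ?_, fun ⟨q, hq, _⟩ => hq.ne' (length_eq_zero q)⟩
  exact not_subsingleton_iff_nontrivial.2 hb inferInstance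

end LinePoints

section HereditarySaturated

variable {V : Type u} [Quiver.{v} V]

theorem subset_hsClosure (S : Set V) : S ⊆ hsClosure S :=
  fun _ ha _ hH => hH.1 ha

theorem isSaturated_hsClosure (S : Set V) : IsSaturated (hsClosure S) :=
  fun a ha h H hH => hH.2.2 a ha fun b e => h b e H hH

theorem IsSaturated.exists_hom_remove (hrow : RowFinite V) {G : Set V} (hG : IsSaturated G)
    (hsink : ∀ a : V, IsEmpty (Quiver.Star a) → a ∈ G) (a : Remove G) :
    ∃ b : Remove G, Nonempty (a ⟶ b) := by
  by_contra! h
  have hne : Nonempty (Quiver.Star a.1) := not_isEmpty_iff.1 fun hs => a.2 (hsink a.1 hs)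
  refine a.2 (hG a.1 ⟨hne, hrow a.1⟩ fun b e => ?_)
  by_contra hb
  exact (h ⟨b, hb⟩).false e

theorem exists_hom_remove_hsClosure_linePoints (hrow : RowFinite V)
    (a : Remove (hsClosure (linePoints V))) :
    ∃ b : Remove (hsClosure (linePoints V)), Nonempty (a ⟶ b) :=
  (isSaturated_hsClosure _).exists_hom_remove hrow
    (fun _ _ => subset_hsClosure _ isLinePoint_of_isEmpty_star) a

theorem Rayless.linePointsOff_hsClosure_linePoints (hV : Rayless V) (hrow : RowFinite V) :
    linePointsOff (hsClosure (linePoints V)) = ∅ := by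
  rw [linePointsOff,
    (hV.remove _).linePoints_eq_empty (exists_hom_remove_hsClosure_linePoints hrow),
    Set.image_empty]

theorem exists_hom_notMem_range_of_mem_linePointsOff (hrow : RowFinite V) {k : ℕ}
    {u : Fin (k + 1) → V} (hu : ∀ i, u i ∉ hsClosure (linePoints V))
    (hhom : ∀ i : Fin k, Nonempty (u i.castSucc ⟶ u i.succ))
    (h0 : u 0 ∈ linePointsOff (hsClosure (linePoints V))) :
    ∃ b ∉ Set.range u, b ∉ hsClosure (linePoints V) ∧ Nonempty (u (Fin.last k) ⟶ b) := by
  let u' (i : Fin (k + 1)) : Remove (hsClosure (linePoints V)) := ⟨u i, hu i⟩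
  have h0' : IsLinePoint (u' 0) := by
    obtain ⟨a, ha, ha0⟩ := h0
    rwa [show u' 0 = a from Subtype.ext ha0.symm]
  obtain ⟨b, hb, e⟩ :=
    h0'.exists_hom_notMem_range (exists_hom_remove_hsClosure_linePoints hrow) hhom
  exact ⟨b.1, fun ⟨i, hi⟩ => hb ⟨i, Subtype.ext hi⟩, b.2, e⟩

end HereditarySaturated

section Series

theorem eq_apply_one_of_isFixedPt {L : Type*} [CompleteLattice L] {f : Ordinal.{u} → L}
    {g : L → L} (hzero : f 0 = ⊥) (hsucc : ∀ α ≠ 0, f (α + 1) = g (f α))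
    (hlimit : ∀ β, Order.IsSuccLimit β → f β = ⨆ α < β, f α) (hg : Function.IsFixedPt g (f 1))
    {α : Ordinal.{u}} (hα : α ≠ 0) : f α = f 1 := by
  induction α using Ordinal.limitRecOn with
  | zero => exact absurd rfl hα
  | add_one α ih =>
    rcases eq_or_ne α 0 with rfl | h
    · rw [zero_add]
    · rw [hsucc α h, ih h, hg]
  | limit β hβ ih =>
    rw [hlimit β hβ]
    refine le_antisymm (iSup₂_le fun α hαβ => ?_)
      (le_iSup₂_of_le 1 (Ordinal.one_lt_of_isSuccLimit hβ) le_rfl)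
    rcases eq_or_ne α 0 with rfl | h
    · exact hzero.trans_le bot_le
    · exact (ih α hαβ h).le

theorem iSup_eq_apply_one_of_isFixedPt {L : Type*} [CompleteLattice L] {f : Ordinal.{u} → L}
    {g : L → L} (hzero : f 0 = ⊥) (hsucc : ∀ α ≠ 0, f (α + 1) = g (f α))
    (hlimit : ∀ β, Order.IsSuccLimit β → f β = ⨆ α < β, f α) (hg : Function.IsFixedPt g (f 1)) :
    ⨆ α, f α = f 1 := by
  refine (iSup_le fun α => ?_).antisymm (le_iSup f 1)
  rcases eq_or_ne α 0 with rfl | h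
  · exact hzero.trans_le bot_le
  · exact (eq_apply_one_of_isFixedPt hzero hsucc hlimit hg h).le

theorem linePointSeries_one (V : Type u) [Quiver.{v} V] :
    linePointSeries V 1 = linePoints V := by
  rw [linePointSeries, ← zero_add 1, Ordinal.limitRecOn_add_one, if_pos rfl]

theorem linePointUnion_eq_linePointSeries_one (V : Type u) [Quiver.{v} V]
    (h : linePointsOff (hsClosure (linePoints V)) = ∅) :
    linePointUnion V = linePointSeries V 1 := by
  refine iSup_eq_apply_one_of_isFixedPt (g := fun S => S ∪ linePointsOff (hsClosure S))
    (by simp [linePointSeries]) (fun α hα => by simp [linePointSeries, hα])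
    (fun β hβ => by rw [linePointSeries, Ordinal.limitRecOn_limit _ _ _ _ hβ]; rfl) ?_
  rw [linePointSeries_one, Function.IsFixedPt, h, Set.union_empty]

variable (A : Type w) [NonUnitalRing A]

theorem socleSeries_one : socleSeries A 1 = socle A := by
  rw [socleSeries, ← zero_add 1, Ordinal.limitRecOn_add_one, if_pos rfl]

theorem socleSeries_two : socleSeries A 2 = socleOver (socle A) := by
  rw [← socleSeries_one, ← one_add_one_eq_two]
  simp [socleSeries]

theorem socleSum_eq_socleSeries_one (h : socleOver (socle A) = socle A) :
    socleSum A = socleSeries A 1 := by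
  refine iSup_eq_apply_one_of_isFixedPt (g := socleOver)
    (by simp [socleSeries]) (fun α hα => by simp [socleSeries, hα])
    (fun β hβ => by rw [socleSeries, Ordinal.limitRecOn_limit _ _ _ _ hβ]; rfl) ?_
  rwa [socleSeries_one]

end Series

section Socle

variable {A : Type w} [NonUnitalRing A]

theorem mem_socle {x : A} : x ∈ socle A ↔ x ∈ socleAddSubgroup A :=
  TwoSidedIdeal.mem_mk' ..

theorem quotientMap_eq_zero_iff {I : TwoSidedIdeal A} {x : A} : quotientMap I x = 0 ↔ x ∈ I :=
  RingCon.eq _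

theorem quotientMap_surjective (I : TwoSidedIdeal A) : Function.Surjective (quotientMap I) :=
  Quotient.mk''_surjective

/-- The element `b` is minimal modulo the ideal `I` if its class is nonzero and lies in the left
ideal generated by any nonzero left multiple of it. This is the elementwise form of minimality of
left ideals of `A / I`, stated in `A`. -/
def IsMinimalModulo (I : TwoSidedIdeal A) (b : A) : Prop :=
  b ∉ I ∧ ∀ r, r * b ∉ I → ∃ y, y * (r * b) - b ∈ I

theorem IsMinimalModulo.mul_left {I : TwoSidedIdeal A} {b : A} (hb : IsMinimalModulo I b) {a : A}
    (hab : a * b ∉ I) : IsMinimalModulo I (a * b) := by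
  refine ⟨hab, fun r hr => ?_⟩
  obtain ⟨y, hy⟩ := hb.2 (r * a) (by rwa [mul_assoc])
  refine ⟨a * y, ?_⟩
  simpa only [mul_sub, mul_assoc] using I.mul_mem_left a _ hy

theorem IsMinimalModulo.mul_right {I : TwoSidedIdeal A} {b : A} (hb : IsMinimalModulo I b) {a : A}
    (hab : b * a ∉ I) : IsMinimalModulo I (b * a) := by
  refine ⟨hab, fun r hr => ?_⟩
  obtain ⟨y, hy⟩ := hb.2 r fun h => hr (by rw [← mul_assoc]; exact I.mul_mem_right _ _ h)
  refine ⟨y, ?_⟩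
  simpa only [sub_mul, mul_assoc] using I.mul_mem_right _ a hy

theorem IsMinimalModulo.of_quotientMap {I : TwoSidedIdeal A} {b : A}
    (hb : IsMinimalModulo ⊥ (quotientMap I b)) : IsMinimalModulo I b := by
  simp only [IsMinimalModulo, TwoSidedIdeal.mem_bot, (quotientMap_surjective I).forall,
    (quotientMap_surjective I).exists, ← map_mul, ← map_sub, quotientMap_eq_zero_iff] at hb
  exact hb

theorem isLeftIdeal_range_mulRight (b : A) : IsLeftIdeal (AddMonoidHom.mulRight b).range := by
  rintro a _ ⟨y, rfl⟩
  exact ⟨a * y, mul_assoc a y b⟩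

theorem IsMinimalLeftIdeal.isMinimalModulo {M : AddSubgroup A} (hM : IsMinimalLeftIdeal M)
    (hunit : ∀ a : A, ∃ u, u * a = a) {I : TwoSidedIdeal A} {b : A} (hbM : b ∈ M) (hbI : b ∉ I) :
    IsMinimalModulo I b := by
  refine ⟨hbI, fun r hr => ?_⟩
  have ne_bot : (AddMonoidHom.mulRight (r * b)).range ≠ ⊥ := by
    obtain ⟨u, hu⟩ := hunit (r * b)
    intro hbot
    have hrb : r * b ∈ (AddMonoidHom.mulRight (r * b)).range := ⟨u, hu⟩
    rw [hbot, AddSubgroup.mem_bot] at hrb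
    exact hr (hrb ▸ I.zero_mem)
  have hle : (AddMonoidHom.mulRight (r * b)).range ≤ M := by
    rintro _ ⟨y, rfl⟩
    exact hM.1.1 y _ (hM.1.1 r b hbM)
  obtain ⟨y, hy⟩ := hM.2 ⟨isLeftIdeal_range_mulRight _, ne_bot⟩ hle hbM
  exact ⟨y, by rw [← AddMonoidHom.mulRight_apply, hy, sub_self]; exact I.zero_mem⟩

theorem IsMinimalModulo.mem_socle {b : A} (hb : IsMinimalModulo ⊥ b) (hunit : ∃ u, u * b = b) :
    b ∈ socle A := by
  suffices hM : IsMinimalLeftIdeal (AddMonoidHom.mulRight b).range from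
    LeavittQuiver.mem_socle.2 ((le_sSup hM : _ ≤ socleAddSubgroup A) hunit)
  refine ⟨⟨isLeftIdeal_range_mulRight b, fun hbot => hb.1 ?_⟩, ?_⟩
  · rw [TwoSidedIdeal.mem_bot, ← AddSubgroup.mem_bot, ← hbot]
    exact hunit
  · rintro N ⟨hN, hN0⟩ hNM
    obtain ⟨p, hpN, hp0⟩ := N.bot_or_exists_ne_zero.resolve_left hN0
    obtain ⟨z, rfl⟩ := hNM hpN
    obtain ⟨y, hy⟩ := hb.2 z hp0
    have hbN : b ∈ N := by
      rw [← sub_eq_zero.1 hy]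
      exact hN y _ hpN
    rintro _ ⟨a, rfl⟩
    exact hN a b hbN

theorem socle_le_of_forall_not_isMinimalModulo (hunit : ∀ a : A, ∃ u, u * a = a)
    {I : TwoSidedIdeal A} (h : ∀ b, ¬ IsMinimalModulo I b) : socle A ≤ I := by
  have hle : socleAddSubgroup A ≤ (quotientMap I : A →+ I.ringCon.Quotient).ker :=
    sSup_le fun M hM b hbM => quotientMap_eq_zero_iff.2 <| by
      by_contra hbI
      exact h b (hM.isMinimalModulo hunit hbM hbI)
  exact fun x hx => quotientMap_eq_zero_iff.1 (hle (mem_socle.1 hx))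

theorem socleOver_eq_self_of_forall_not_isMinimalModulo (hunit : ∀ a : A, ∃ u, u * a = a)
    {I : TwoSidedIdeal A} (h : ∀ b, ¬ IsMinimalModulo I b) : socleOver I = I := by
  have hunit' : ∀ a : I.ringCon.Quotient, ∃ u, u * a = a := by
    rw [(quotientMap_surjective I).forall]
    exact fun a => (hunit a).imp' (quotientMap I) fun u hu => by rw [← map_mul, hu]
  have hbot : socle I.ringCon.Quotient = ⊥ := le_bot_iff.1 <|
    socle_le_of_forall_not_isMinimalModulo hunit' <|
      (quotientMap_surjective I).forall.2 fun b hb => h b hb.of_quotientMap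
  ext x
  rw [socleOver, hbot, TwoSidedIdeal.mem_comap, TwoSidedIdeal.mem_bot, quotientMap_eq_zero_iff]

end Socle

section UniversalProperty

variable {K : Type w} [Field K] {V : Type u} [Quiver.{v} V]

theorem toLeavitt_mul (x y : FreeAlg K V) :
    toLeavitt K V (x * y) = toLeavitt K V x * toLeavitt K V y := rfl

theorem toLeavitt_smul (k : K) (x : FreeAlg K V) :
    toLeavitt K V (k • x) = k • toLeavitt K V x := rfl

theorem toLeavitt_eq_of_rel {x y : FreeAlg K V} (h : Rel K V x y) :
    toLeavitt K V x = toLeavitt K V y :=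
  (RingCon.eq _).2 (RingConGen.Rel.of _ _ ⟨1, x, y, h, (one_smul _ _).symm, (one_smul _ _).symm⟩)

variable {B : Type*} [NonUnitalNonAssocSemiring B] [Module K B]

theorem apply_eq_of_leavittCon (φ : FreeAlg K V →ₙₐ[K] B)
    (hφ : ∀ ⦃x y⦄, Rel K V x y → φ x = φ y) {x y : FreeAlg K V} (h : leavittCon K V x y) :
    φ x = φ y := by
  change RingConGen.Rel (ScaledRel K V) x y at h
  induction h with
  | of x y h =>
    obtain ⟨k, x, y, h, rfl, rfl⟩ := h
    rw [map_smul, map_smul, hφ h]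
  | refl x => rfl
  | symm _ ih => exact ih.symm
  | trans _ _ ih ih' => exact ih.trans ih'
  | add _ _ ih ih' => rw [map_add, map_add, ih, ih']
  | mul _ _ ih ih' => rw [map_mul, map_mul, ih, ih']

/-- The universal property of the Leavitt path algebra: homomorphisms from the free algebra that
respect the defining relations descend to it. -/
noncomputable def leavittLift (φ : FreeAlg K V →ₙₐ[K] B) (hφ : ∀ ⦃x y⦄, Rel K V x y → φ x = φ y) :
    LeavittPathAlgebra K V →ₙₐ[K] B where
  toFun := Quotient.lift φ fun _ _ h => apply_eq_of_leavittCon φ hφ h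
  map_smul' k := (toLeavitt_surjective K V).forall.2 fun x => map_smul φ k x
  map_zero' := map_zero φ
  map_add' := (toLeavitt_surjective K V).forall₂.2 fun x y => map_add φ x y
  map_mul' := (toLeavitt_surjective K V).forall₂.2 fun x y => map_mul φ x y

end UniversalProperty

section Generators

variable (K : Type w) [Field K] {V : Type u} [Quiver.{v} V]

/-- The vertex `a` as an element of the Leavitt path algebra. -/
noncomputable def vertex (a : V) : LeavittPathAlgebra K V := toLeavitt K V (fVertex K a)

/-- The arrow `e` as an element of the Leavitt path algebra. -/
noncomputable def arrow (e : Quiver.Total V) : LeavittPathAlgebra K V :=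
  toLeavitt K V (fArrow K e)

/-- The ghost arrow `e*` as an element of the Leavitt path algebra. -/
noncomputable def ghost (e : Quiver.Total V) : LeavittPathAlgebra K V :=
  toLeavitt K V (fGhost K e)

theorem vertex_mul_self (a : V) : vertex K a * vertex K a = vertex K a :=
  toLeavitt_eq_of_rel (.vertex_mul_self a)

theorem source_mul_arrow (e : Quiver.Total V) : vertex K e.left * arrow K e = arrow K e :=
  toLeavitt_eq_of_rel (.source_arrow e)

theorem arrow_mul_range (e : Quiver.Total V) : arrow K e * vertex K e.right = arrow K e :=
  toLeavitt_eq_of_rel (.arrow_range e)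

theorem range_mul_ghost (e : Quiver.Total V) : vertex K e.right * ghost K e = ghost K e :=
  toLeavitt_eq_of_rel (.range_ghost e)

theorem ghost_mul_source (e : Quiver.Total V) : ghost K e * vertex K e.left = ghost K e :=
  toLeavitt_eq_of_rel (.ghost_source e)

theorem ghost_mul_arrow_self (e : Quiver.Total V) :
    ghost K e * arrow K e = vertex K e.right :=
  toLeavitt_eq_of_rel (.ck1_self e)

theorem vertex_eq_sum (a : V) (h : Nonempty (Quiver.Star a)) [Fintype (Quiver.Star a)] :
    vertex K a = ∑ p : Quiver.Star a, arrow K (starArrow p) * ghost K (starArrow p) := by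
  rw [vertex, toLeavitt_eq_of_rel (.ck2 a h inferInstance), map_sum]
  rfl

variable {K}

theorem vertex_mul_vertex_of_ne {a b : V} (h : a ≠ b) : vertex K a * vertex K b = 0 :=
  toLeavitt_eq_of_rel (.vertex_mul_ne a b h)

theorem ghost_mul_arrow_of_ne {e f : Quiver.Total V} (h : e ≠ f) : ghost K e * arrow K f = 0 :=
  toLeavitt_eq_of_rel (.ck1_ne e f h)

theorem vertex_mul_arrow_of_ne {a : V} {e : Quiver.Total V} (h : a ≠ e.left) :
    vertex K a * arrow K e = 0 := by
  rw [← source_mul_arrow, ← mul_assoc, vertex_mul_vertex_of_ne h, zero_mul]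

theorem ghost_mul_vertex_of_ne {a : V} {e : Quiver.Total V} (h : e.left ≠ a) :
    ghost K e * vertex K a = 0 := by
  rw [← ghost_mul_source, mul_assoc, vertex_mul_vertex_of_ne h, mul_zero]

theorem leavitt_induction {P : LeavittPathAlgebra K V → Prop} (x : LeavittPathAlgebra K V)
    (vertex : ∀ a, P (vertex K a)) (arrow : ∀ e, P (arrow K e)) (ghost : ∀ e, P (ghost K e))
    (zero : P 0) (add : ∀ x y, P x → P y → P (x + y)) (mul : ∀ x y, P x → P y → P (x * y))
    (smul : ∀ (k : K) x, P x → P (k • x)) : P x := by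
  have generator (g : Gen V) :
      P (toLeavitt K V (MonoidAlgebra.single (FreeSemigroup.of g) 1)) := by
    rcases g with a | e | e
    exacts [vertex a, arrow e, ghost e]
  have word (s : FreeSemigroup (Gen V)) : P (toLeavitt K V (MonoidAlgebra.single s 1)) := by
    induction s using FreeSemigroup.recOnMul with
    | ih1 g => exact generator g
    | ih2 g s _ ih =>
      rw [← one_mul (1 : K), ← MonoidAlgebra.single_mul_single, toLeavitt_mul]
      exact mul _ _ (generator g) ih
  obtain ⟨x, rfl⟩ := toLeavitt_surjective K V x
  induction x using MonoidAlgebra.induction_linear with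
  | zero => rwa [map_zero]
  | add x y hx hy => rw [map_add]; exact add _ _ hx hy
  | single s k =>
    rw [← mul_one k, ← smul_eq_mul, ← MonoidAlgebra.smul_single, toLeavitt_smul]
    exact smul _ _ (word s)

end Generators

section LocalUnits

open Filter

variable {K : Type w} [Field K] {V : Type u} [Quiver.{v} V]

theorem sum_vertex_mul_of_vertex_mul {t : Finset V} {a : V} (ha : a ∈ t)
    {x : LeavittPathAlgebra K V} (hx : vertex K a * x = x) : (∑ c ∈ t, vertex K c) * x = x := by
  rw [← hx, ← mul_assoc, Finset.sum_mul, Finset.sum_eq_single_of_mem a ha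
    fun c _ hc => vertex_mul_vertex_of_ne hc, vertex_mul_self]

theorem mul_sum_vertex_of_mul_vertex {t : Finset V} {a : V} (ha : a ∈ t)
    {x : LeavittPathAlgebra K V} (hx : x * vertex K a = x) : x * ∑ c ∈ t, vertex K c = x := by
  rw [← hx, mul_assoc, Finset.mul_sum, Finset.sum_eq_single_of_mem a ha
    fun c _ hc => vertex_mul_vertex_of_ne hc.symm, vertex_mul_self]

theorem eventually_sum_vertex_mul (x : LeavittPathAlgebra K V) :
    ∀ᶠ t : Finset V in atTop, (∑ a ∈ t, vertex K a) * x = x := by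
  have of_vertex_mul {a : V} {x : LeavittPathAlgebra K V} (hx : vertex K a * x = x) :
      ∀ᶠ t : Finset V in atTop, (∑ a ∈ t, vertex K a) * x = x :=
    (eventually_ge_atTop {a}).mono fun t ht =>
      sum_vertex_mul_of_vertex_mul (Finset.singleton_subset_iff.1 ht) hx
  induction x using leavitt_induction with
  | vertex a => exact of_vertex_mul (vertex_mul_self K a)
  | arrow e => exact of_vertex_mul (source_mul_arrow K e)
  | ghost e => exact of_vertex_mul (range_mul_ghost K e)
  | zero => exact .of_forall fun t => mul_zero _
  | add x y hx hy => filter_upwards [hx, hy] with t hx hy; rw [mul_add, hx, hy]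
  | mul x y hx _ => filter_upwards [hx] with t hx; rw [← mul_assoc, hx]
  | smul k x hx => filter_upwards [hx] with t hx; rw [mul_smul_comm, hx]

theorem eventually_mul_sum_vertex (x : LeavittPathAlgebra K V) :
    ∀ᶠ t : Finset V in atTop, x * ∑ a ∈ t, vertex K a = x := by
  have of_mul_vertex {a : V} {x : LeavittPathAlgebra K V} (hx : x * vertex K a = x) :
      ∀ᶠ t : Finset V in atTop, x * ∑ a ∈ t, vertex K a = x :=
    (eventually_ge_atTop {a}).mono fun t ht =>
      mul_sum_vertex_of_mul_vertex (Finset.singleton_subset_iff.1 ht) hx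
  induction x using leavitt_induction with
  | vertex a => exact of_mul_vertex (vertex_mul_self K a)
  | arrow e => exact of_mul_vertex (arrow_mul_range K e)
  | ghost e => exact of_mul_vertex (ghost_mul_source K e)
  | zero => exact .of_forall fun t => zero_mul _
  | add x y hx hy => filter_upwards [hx, hy] with t hx hy; rw [add_mul, hx, hy]
  | mul x y _ hy => filter_upwards [hy] with t hy; rw [mul_assoc, hy]
  | smul k x hx => filter_upwards [hx] with t hx; rw [smul_mul_assoc, hx]

theorem exists_mul_eq_self (x : LeavittPathAlgebra K V) : ∃ y, y * x = x :=
  (eventually_sum_vertex_mul x).exists.imp' _ fun _ => id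

theorem exists_mul_vertex_notMem {I : TwoSidedIdeal (LeavittPathAlgebra K V)}
    {x : LeavittPathAlgebra K V} (hx : x ∉ I) : ∃ a, x * vertex K a ∉ I := by
  obtain ⟨t, ht⟩ := (eventually_mul_sum_vertex x).exists
  by_contra! h
  rw [← ht, Finset.mul_sum] at hx
  exact hx (sum_mem fun a _ => h a)

end LocalUnits

section PathSpan

open Filter

variable {K : Type w} [Field K] {V : Type u} [Quiver.{v} V]

variable (K) in
/-- The products of `n` arrows and the vertex `a`, in this order: the paths of length `n` that
end in `a`, and zeros that come from arrows that do not compose. -/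
inductive IsWord (a : V) : ℕ → LeavittPathAlgebra K V → Prop
  | nil : IsWord a 0 (vertex K a)
  | cons (e : Quiver.Total V) {n : ℕ} {x : LeavittPathAlgebra K V} (h : IsWord a n x) :
      IsWord a (n + 1) (arrow K e * x)

theorem IsWord.mul_vertex {a : V} {n : ℕ} {x : LeavittPathAlgebra K V} (h : IsWord K a n x) :
    x * vertex K a = x := by
  induction h with
  | nil => exact vertex_mul_self K a
  | cons e _ ih => rw [mul_assoc, ih]

theorem IsWord.vertex_mul {a : V} {n : ℕ} {x : LeavittPathAlgebra K V} (h : IsWord K a n x)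
    (b : V) : vertex K b * x = x ∨ vertex K b * x = 0 := by
  cases h with
  | nil =>
    obtain rfl | hb := eq_or_ne b a
    exacts [.inl (vertex_mul_self K b), .inr (vertex_mul_vertex_of_ne hb)]
  | cons e _ =>
    rw [← mul_assoc]
    obtain rfl | hb := eq_or_ne b e.left
    · exact .inl (by rw [source_mul_arrow])
    · exact .inr (by rw [vertex_mul_arrow_of_ne hb, zero_mul])

theorem IsWord.mul_arrow {e : Quiver.Total V} {n : ℕ} {x : LeavittPathAlgebra K V}
    (h : IsWord K e.left n x) : IsWord K e.right (n + 1) (x * arrow K e) := by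
  generalize ha : e.left = a at h
  induction h with
  | nil =>
    subst ha
    rw [source_mul_arrow, ← arrow_mul_range]
    exact .cons e .nil
  | cons f _ ih =>
    rw [mul_assoc]
    exact .cons f ih

variable (K) in
/-- The subspace of the Leavitt path algebra spanned by the paths that end in the vertex `a` and
whose length belongs to `s`. -/
noncomputable def pathSpan (a : V) (s : Set ℕ) : Submodule K (LeavittPathAlgebra K V) :=
  Submodule.span K {x | ∃ n ∈ s, IsWord K a n x}

theorem IsWord.mem_pathSpan {a : V} {n : ℕ} {x : LeavittPathAlgebra K V} (h : IsWord K a n x)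
    {s : Set ℕ} (hn : n ∈ s) : x ∈ pathSpan K a s :=
  Submodule.subset_span ⟨n, hn, h⟩

theorem pathSpan_le {a : V} {s : Set ℕ} {T : Submodule K (LeavittPathAlgebra K V)} :
    pathSpan K a s ≤ T ↔ ∀ n ∈ s, ∀ x, IsWord K a n x → x ∈ T :=
  Submodule.span_le.trans ⟨fun h n hn _ hx => h ⟨n, hn, hx⟩, fun h _ ⟨n, hn, hx⟩ => h n hn _ hx⟩

theorem pathSpan_mono (a : V) : Monotone (pathSpan K a) :=
  fun _ _ hst => pathSpan_le.2 fun _ hn _ hx => hx.mem_pathSpan (hst hn)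

variable {a : V} {s : Set ℕ} {x : LeavittPathAlgebra K V}

theorem vertex_mul_mem_pathSpan (hx : x ∈ pathSpan K a s) (b : V) :
    vertex K b * x ∈ pathSpan K a s := by
  refine pathSpan_le (T := (pathSpan K a s).comap (LinearMap.mulLeft K _)) |>.2 ?_ hx
  intro n hn y hy
  obtain h | h := hy.vertex_mul b <;> rw [Submodule.mem_comap, LinearMap.mulLeft_apply, h]
  exacts [hy.mem_pathSpan hn, zero_mem _]

theorem arrow_mul_mem_pathSpan {t : Set ℕ} (hst : ∀ n ∈ s, n + 1 ∈ t)
    (hx : x ∈ pathSpan K a s) (e : Quiver.Total V) : arrow K e * x ∈ pathSpan K a t :=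
  pathSpan_le (T := (pathSpan K a t).comap (LinearMap.mulLeft K _)) |>.2
    (fun n hn _ hy => (hy.cons e).mem_pathSpan (hst n hn)) hx

theorem mul_arrow_mem_pathSpan {e : Quiver.Total V} {t : Set ℕ} (hst : ∀ n ∈ s, n + 1 ∈ t)
    (hx : x ∈ pathSpan K e.left s) : x * arrow K e ∈ pathSpan K e.right t :=
  pathSpan_le (T := (pathSpan K e.right t).comap (LinearMap.mulRight K _)) |>.2
    (fun n hn _ hy => hy.mul_arrow.mem_pathSpan (hst n hn)) hx

theorem IsWord.ghost_mul_arrow_mul_mem_pathSpan {n : ℕ} (h : IsWord K a n x) (hn : n ∈ s)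
    (e f : Quiver.Total V) : ghost K e * (arrow K f * x) ∈ pathSpan K a s := by
  rw [← mul_assoc]
  obtain rfl | hef := eq_or_ne e f
  · rw [ghost_mul_arrow_self]
    exact vertex_mul_mem_pathSpan (h.mem_pathSpan hn) _
  · rw [ghost_mul_arrow_of_ne hef, zero_mul]
    exact zero_mem _

theorem ghost_mul_mem_pathSpan {t : Set ℕ} (h0 : 0 ∉ s) (hst : ∀ n, n + 1 ∈ s → n ∈ t)
    (hx : x ∈ pathSpan K a s) (e : Quiver.Total V) : ghost K e * x ∈ pathSpan K a t := by
  refine pathSpan_le (T := (pathSpan K a t).comap (LinearMap.mulLeft K _)) |>.2 ?_ hx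
  rintro _ hn _ (_ | ⟨f, hy⟩)
  exacts [absurd hn h0, hy.ghost_mul_arrow_mul_mem_pathSpan (hst _ hn) e f]

theorem eventually_mem_pathSpan_Iio (hx : x ∈ pathSpan K a Set.univ) :
    ∀ᶠ n in atTop, x ∈ pathSpan K a (Set.Iio n) := by
  induction hx using Submodule.span_induction with
  | mem x hx =>
    obtain ⟨m, -, hm⟩ := hx
    exact (eventually_gt_atTop m).mono fun n hn => hm.mem_pathSpan hn
  | zero => exact .of_forall fun n => zero_mem _
  | add x y _ _ hx hy => filter_upwards [hx, hy] with n hx hy using add_mem hx hy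
  | smul k x _ hx => filter_upwards [hx] with n hx using Submodule.smul_mem _ k hx

theorem exists_sub_smul_vertex_mem_pathSpan (hx : x ∈ pathSpan K a s) :
    ∃ k : K, x - k • vertex K a ∈ pathSpan K a (s \ {0}) := by
  have hle : pathSpan K a s ≤ Submodule.span K {vertex K a} ⊔ pathSpan K a (s \ {0}) := by
    refine pathSpan_le.2 ?_
    rintro _ hn _ (_ | ⟨e, hy⟩)
    · exact Submodule.mem_sup_left (Submodule.mem_span_singleton_self _)
    · exact Submodule.mem_sup_right ((hy.cons e).mem_pathSpan ⟨hn, Nat.succ_ne_zero _⟩)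
  obtain ⟨_, hk, y, hy, rfl⟩ := Submodule.mem_sup.1 (hle hx)
  obtain ⟨k, rfl⟩ := Submodule.mem_span_singleton.1 hk
  exact ⟨k, by rwa [add_sub_cancel_left]⟩

theorem exists_mul_mem_pathSpan_Ici (x : LeavittPathAlgebra K V) :
    ∃ N, ∀ (a : V) (n : ℕ), ∀ y ∈ pathSpan K a (Set.Ici (n + N)),
      x * y ∈ pathSpan K a (Set.Ici n) := by
  induction x using leavitt_induction with
  | vertex b => exact ⟨0, fun a n y hy => vertex_mul_mem_pathSpan hy b⟩
  | arrow e =>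
    exact ⟨0, fun a n y hy => arrow_mul_mem_pathSpan (fun _ hm => Nat.le_succ_of_le hm) hy e⟩
  | ghost e =>
    exact ⟨1, fun a n y hy => ghost_mul_mem_pathSpan (Nat.not_succ_le_zero n)
      (fun _ => Nat.le_of_succ_le_succ) hy e⟩
  | zero => exact ⟨0, fun a n y _ => by rw [zero_mul]; exact zero_mem _⟩
  | add x x' hx hx' =>
    obtain ⟨M, hM⟩ := hx
    obtain ⟨N, hN⟩ := hx'
    refine ⟨max M N, fun a n y hy => ?_⟩
    rw [add_mul]
    exact add_mem (hM a n y (pathSpan_mono a (Set.Ici_subset_Ici.2 (by gcongr; simp)) hy))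
      (hN a n y (pathSpan_mono a (Set.Ici_subset_Ici.2 (by gcongr; simp)) hy))
  | mul x x' hx hx' =>
    obtain ⟨M, hM⟩ := hx
    obtain ⟨N, hN⟩ := hx'
    refine ⟨M + N, fun a n y hy => ?_⟩
    rw [mul_assoc]
    exact hM a n _ (hN a _ y (by rwa [add_assoc]))
  | smul k x hx =>
    obtain ⟨M, hM⟩ := hx
    refine ⟨M, fun a n y hy => ?_⟩
    rw [smul_mul_assoc]
    exact Submodule.smul_mem _ k (hM a n y hy)

theorem mul_mem_pathSpan_of_sink (ha : IsEmpty (Quiver.Star a)) (x : LeavittPathAlgebra K V) :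
    ∀ y ∈ pathSpan K a Set.univ, x * y ∈ pathSpan K a Set.univ := by
  induction x using leavitt_induction with
  | vertex b => exact fun y hy => vertex_mul_mem_pathSpan hy b
  | arrow e => exact fun y hy => arrow_mul_mem_pathSpan (fun n _ => Set.mem_univ (n + 1)) hy e
  | ghost e =>
    refine pathSpan_le (T := (pathSpan K a _).comap (LinearMap.mulLeft K _)) |>.2 ?_
    rintro _ - _ (_ | ⟨f, hy⟩)
    · have he : e.left ≠ a := by
        rintro rfl
        exact ha.elim ⟨_, e.hom⟩
      rw [Submodule.mem_comap, LinearMap.mulLeft_apply, ghost_mul_vertex_of_ne he]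
      exact zero_mem _
    · exact hy.ghost_mul_arrow_mul_mem_pathSpan (Set.mem_univ _) e f
  | zero => exact fun y _ => by rw [zero_mul]; exact zero_mem _
  | add x x' hx hx' => exact fun y hy => by rw [add_mul]; exact add_mem (hx y hy) (hx' y hy)
  | mul x x' hx hx' => exact fun y hy => by rw [mul_assoc]; exact hx _ (hx' y hy)
  | smul k x hx =>
    exact fun y hy => by rw [smul_mul_assoc]; exact Submodule.smul_mem _ k (hx y hy)

theorem vertex_mul_eq_zero_of_sink (ha : IsEmpty (Quiver.Star a)) (h0 : 0 ∉ s)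
    (hx : x ∈ pathSpan K a s) : vertex K a * x = 0 := by
  refine pathSpan_le (T := LinearMap.ker (LinearMap.mulLeft K (vertex K a))) |>.2 ?_ hx
  rintro _ hn _ (_ | ⟨e, hy⟩)
  · exact absurd hn h0
  · have he : a ≠ e.left := by
      rintro rfl
      exact ha.elim ⟨_, e.hom⟩
    rw [LinearMap.mem_ker, LinearMap.mulLeft_apply, ← mul_assoc, vertex_mul_arrow_of_ne he,
      zero_mul]

-- On paths of positive length the finite sums of the idempotents `e e*` act as local units, no
-- matter whether the relation (CK2) is available.
theorem eventually_sum_arrow_mul_ghost_mul (h0 : 0 ∉ s) (hx : x ∈ pathSpan K a s) :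
    ∀ᶠ t : Finset (Quiver.Total V) in atTop, ∑ e ∈ t, arrow K e * (ghost K e * x) = x := by
  induction hx using Submodule.span_induction with
  | mem x hx =>
    obtain ⟨_, hn, _ | ⟨f, hy⟩⟩ := hx
    · exact absurd hn h0
    refine (eventually_ge_atTop {f}).mono fun t ht => ?_
    rw [Finset.sum_eq_single_of_mem f (Finset.singleton_subset_iff.1 ht)]
    · rw [← mul_assoc (ghost K f), ghost_mul_arrow_self, ← mul_assoc, arrow_mul_range]
    · intro e _ hef
      rw [← mul_assoc (ghost K e), ghost_mul_arrow_of_ne hef, zero_mul, mul_zero]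
  | zero => exact .of_forall fun t => by simp only [mul_zero, Finset.sum_const_zero]
  | add x y _ _ hx hy =>
    filter_upwards [hx, hy] with t hx hy
    simp only [mul_add, Finset.sum_add_distrib, hx, hy]
  | smul k x _ hx =>
    filter_upwards [hx] with t hx
    simp only [mul_smul_comm, ← Finset.smul_sum, hx]

theorem exists_ghost_mul_notMem {I : TwoSidedIdeal (LeavittPathAlgebra K V)} (h0 : 0 ∉ s)
    (hx : x ∈ pathSpan K a s) (hxI : x ∉ I) : ∃ e, ghost K e * x ∉ I := by
  obtain ⟨t, ht⟩ := (eventually_sum_arrow_mul_ghost_mul h0 hx).exists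
  by_contra! h
  rw [← ht] at hxI
  exact hxI (sum_mem fun e _ => I.mul_mem_left _ _ (h e))

end PathSpan

section PrincipalUnits

variable {K : Type w} [Field K] {V : Type u} [Quiver.{v} V] {a : V}

/-- A principal unit at `a` is the vertex `a` plus a combination of paths of positive length that
end in `a`. The name is by analogy with the elements `1 + 𝔪` of a local ring. -/
def IsPrincipalUnitAt (a : V) (q : LeavittPathAlgebra K V) : Prop :=
  q - vertex K a ∈ pathSpan K a (Set.Ici 1)

theorem exists_mul_isPrincipalUnitAt_of_mem_pathSpan_Iio
    {I : TwoSidedIdeal (LeavittPathAlgebra K V)} {n : ℕ} {p : LeavittPathAlgebra K V}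
    (hp : p ∈ pathSpan K a (Set.Iio n)) (hpI : p ∉ I) : ∃ y, IsPrincipalUnitAt a (y * p) := by
  induction n generalizing p with
  | zero =>
    have hp0 : p ∈ (⊥ : Submodule K (LeavittPathAlgebra K V)) :=
      pathSpan_le.2 (fun m hm => absurd hm m.not_lt_zero) hp
    rw [(Submodule.mem_bot K).1 hp0] at hpI
    exact absurd I.zero_mem hpI
  | succ n ih =>
    obtain ⟨k, hk⟩ := exists_sub_smul_vertex_mem_pathSpan hp
    obtain rfl | hk0 := eq_or_ne k 0
    · rw [zero_smul, sub_zero] at hk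
      obtain ⟨e, he⟩ := exists_ghost_mul_notMem (fun h => h.2 rfl) hk hpI
      obtain ⟨y, hy⟩ := ih (ghost_mul_mem_pathSpan (fun h => h.2 rfl)
        (fun m hm => Nat.lt_of_succ_lt_succ hm.1) hk e) he
      exact ⟨y * ghost K e, by rwa [mul_assoc]⟩
    · refine ⟨k⁻¹ • vertex K a, ?_⟩
      have heq : (k⁻¹ • vertex K a) * p - vertex K a =
          k⁻¹ • (vertex K a * (p - k • vertex K a)) := by
        rw [mul_sub, mul_smul_comm, vertex_mul_self, smul_sub, inv_smul_smul₀ hk0, smul_mul_assoc]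
      rw [IsPrincipalUnitAt, heq]
      exact Submodule.smul_mem _ _ (vertex_mul_mem_pathSpan
        (pathSpan_mono a (fun m hm => Nat.one_le_iff_ne_zero.2 hm.2) hk) a)

theorem exists_mul_isPrincipalUnitAt {I : TwoSidedIdeal (LeavittPathAlgebra K V)}
    {p : LeavittPathAlgebra K V} (hp : p ∈ pathSpan K a Set.univ) (hpI : p ∉ I) :
    ∃ y, IsPrincipalUnitAt a (y * p) := by
  obtain ⟨n, hn⟩ := (eventually_mem_pathSpan_Iio hp).exists
  exact exists_mul_isPrincipalUnitAt_of_mem_pathSpan_Iio hn hpI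

theorem IsPrincipalUnitAt.ghost_mul_mul_arrow {e : Quiver.Total V} {q : LeavittPathAlgebra K V}
    (hq : IsPrincipalUnitAt e.left q) :
    IsPrincipalUnitAt e.right (ghost K e * (q * arrow K e)) := by
  have h := ghost_mul_mem_pathSpan (t := Set.Ici 1) (Nat.not_succ_le_zero 1)
    (fun n => Nat.le_of_succ_le_succ)
    (mul_arrow_mem_pathSpan (t := Set.Ici 2) (fun n hn => Nat.succ_le_succ hn) hq) e
  rwa [sub_mul, mul_sub, source_mul_arrow, ghost_mul_arrow_self] at h

theorem vertex_mem_socle_of_sink (ha : IsEmpty (Quiver.Star a)) :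
    vertex K a ∈ socle (LeavittPathAlgebra K V) := by
  by_cases h0 : vertex K a ∈ (⊥ : TwoSidedIdeal (LeavittPathAlgebra K V))
  · exact (bot_le : ⊥ ≤ socle (LeavittPathAlgebra K V)) h0
  refine IsMinimalModulo.mem_socle ⟨h0, fun r hr => ?_⟩ ⟨_, vertex_mul_self K a⟩
  have hra : r * vertex K a ∈ pathSpan K a Set.univ :=
    mul_mem_pathSpan_of_sink ha r _ (IsWord.nil.mem_pathSpan (Set.mem_univ _))
  obtain ⟨y, hy⟩ := exists_mul_isPrincipalUnitAt hra hr
  have h := vertex_mul_eq_zero_of_sink ha (Nat.not_succ_le_zero 0) hy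
  rw [mul_sub, vertex_mul_self] at h
  exact ⟨vertex K a * y, by rw [mul_assoc, h]; exact TwoSidedIdeal.zero_mem _⟩

end PrincipalUnits

section VerticesOfIdeals

variable {K : Type w} [Field K] {V : Type u} [Quiver.{v} V]

theorem isSaturated_vertex_mem (I : TwoSidedIdeal (LeavittPathAlgebra K V)) :
    IsSaturated {a : V | vertex K a ∈ I} := by
  rintro a ⟨hne, hfin⟩ h
  have := Fintype.ofFinite (Quiver.Star a)
  rw [Set.mem_ofPred_eq, vertex_eq_sum K a hne]
  refine sum_mem fun p _ => ?_
  rw [← arrow_mul_range]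
  exact I.mul_mem_right _ _ (I.mul_mem_left _ _ (h p.1 p.2))

variable {I : TwoSidedIdeal (LeavittPathAlgebra K V)}

theorem exists_mul_arrow_notMem (hrow : RowFinite V)
    (hsink : ∀ a : V, IsEmpty (Quiver.Star a) → vertex K a ∈ I) {b : LeavittPathAlgebra K V}
    (hb : b ∉ I) : ∃ e, b * arrow K e ∉ I := by
  obtain ⟨a, ha⟩ := exists_mul_vertex_notMem hb
  by_contra! h
  obtain hempty | hne := isEmpty_or_nonempty (Quiver.Star a)
  · exact ha (I.mul_mem_left _ _ (hsink a hempty))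
  · have := hrow a
    have := Fintype.ofFinite (Quiver.Star a)
    rw [vertex_eq_sum K a hne, Finset.mul_sum] at ha
    refine ha (sum_mem fun p _ => ?_)
    rw [← mul_assoc]
    exact I.mul_mem_right _ _ (h _)

theorem exists_isWord_mul_notMem (hrow : RowFinite V)
    (hsink : ∀ a : V, IsEmpty (Quiver.Star a) → vertex K a ∈ I) (n : ℕ)
    {b : LeavittPathAlgebra K V} (hb : b ∉ I) : ∃ a x, IsWord K a n x ∧ b * x ∉ I := by
  induction n generalizing b with
  | zero => exact (exists_mul_vertex_notMem hb).imp fun a ha => ⟨_, .nil, ha⟩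
  | succ n ih =>
    obtain ⟨e, he⟩ := exists_mul_arrow_notMem hrow hsink hb
    obtain ⟨a, x, hx, hbx⟩ := ih he
    exact ⟨a, _, hx.cons e, by rwa [← mul_assoc]⟩

end VerticesOfIdeals

section InfinitePaths

variable (V : Type u) [Quiver.{v} V]

/-- An infinite path, given by the sequence of its arrows. -/
@[ext]
structure InfPath where
  /-- The `n`-th arrow, counted from `0`. -/
  edge : ℕ → Quiver.Total V
  right_edge : ∀ n, (edge n).right = (edge (n + 1)).left

variable {V}

namespace InfPath

/-- The first arrow of an infinite path. -/
def head (x : InfPath V) : Quiver.Total V := x.edge 0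

/-- The vertex at which an infinite path starts. -/
def source (x : InfPath V) : V := x.head.left

/-- The infinite path without its first arrow. -/
def tail (x : InfPath V) : InfPath V := ⟨fun n => x.edge (n + 1), fun n => x.right_edge (n + 1)⟩

/-- The infinite path that consists of an arrow followed by an infinite path. -/
def cons (e : Quiver.Total V) (x : InfPath V) (h : e.right = x.source) : InfPath V :=
  ⟨fun n => Nat.casesOn n e x.edge, fun n => by cases n; exacts [h, x.right_edge _]⟩

@[simp] theorem head_cons (e : Quiver.Total V) (x : InfPath V) (h) : (cons e x h).head = e := rfl

@[simp] theorem tail_cons (e : Quiver.Total V) (x : InfPath V) (h) : (cons e x h).tail = x := rfl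

theorem right_head (x : InfPath V) : x.head.right = x.tail.source := x.right_edge 0

theorem exists_source_eq_of_forall_hom {f : ℕ → V} (hf : ∀ n, Nonempty (f n ⟶ f (n + 1))) :
    ∃ x : InfPath V, x.source = f 0 :=
  ⟨⟨fun n => ⟨f n, f (n + 1), (hf n).some⟩, fun _ => rfl⟩, rfl⟩

theorem ext_head_tail {x y : InfPath V} (h : x.head = y.head) (h' : x.tail = y.tail) : x = y := by
  ext1
  funext n
  cases n with
  | zero => exact h
  | succ n => exact congrFun (congrArg edge h') n

theorem cons_head_tail (x : InfPath V) : cons x.head x.tail x.right_head = x :=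
  ext_head_tail (head_cons ..) (tail_cons ..)

theorem edge_tail_iterate (x : InfPath V) (m n : ℕ) : (tail^[m] x).edge n = x.edge (n + m) := by
  induction m generalizing x with
  | zero => rfl
  | succ m ih =>
    rw [Function.iterate_succ_apply, ih]
    exact congrArg x.edge (Nat.add_assoc n m 1)

theorem source_tail_iterate (x : InfPath V) (m : ℕ) : (tail^[m] x).source = (x.edge m).left := by
  rw [source, head, edge_tail_iterate, zero_add]

theorem exists_isPeriodicPt_tail {x : InfPath V} {m : ℕ} (hm : 0 < m)
    (hx : (tail^[m] x).source = x.source) :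
    ∃ y : InfPath V, y.source = x.source ∧ Function.IsPeriodicPt tail m y := by
  refine ⟨⟨fun n => x.edge (n % m), fun n => ?_⟩, by simp only [source, head, Nat.zero_mod], ?_⟩
  · rw [x.right_edge, ← Nat.mod_add_mod n m 1]
    obtain hlt | heq : n % m + 1 < m ∨ n % m + 1 = m := Nat.lt_or_eq_of_le (Nat.mod_lt n hm)
    · rw [Nat.mod_eq_of_lt hlt]
    · rw [heq, Nat.mod_self, ← source_tail_iterate, hx]
      rfl
  · ext1
    funext n
    rw [edge_tail_iterate]
    exact congrArg x.edge (Nat.add_mod_right n m)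

theorem exists_mem_periodicPts_tail (hV : Rayless V) (x : InfPath V) :
    ∃ i, ∃ y ∈ Function.periodicPts tail, (tail^[i] x).source = y.source := by
  obtain ⟨i, j, hij, heq⟩ : ∃ i j, i < j ∧ (x.edge i).left = (x.edge j).left := by
    by_contra! h
    refine hV (fun n => (x.edge n).left) (fun n => ⟨?_⟩) (.of_lt_imp_ne h)
    exact (x.edge n).hom.cast rfl (x.right_edge n)
  obtain ⟨m, hm, rfl⟩ := Nat.exists_eq_add_of_lt hij
  obtain ⟨y, hy, hper⟩ := exists_isPeriodicPt_tail (x := tail^[i] x) (Nat.sub_pos_of_lt hij) <| by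
    rw [← Function.iterate_add_apply, source_tail_iterate, source_tail_iterate, heq,
      Nat.sub_add_cancel hij.le]
  exact ⟨i, y, ⟨_, Nat.sub_pos_of_lt hij, hper⟩, hy.symm⟩

end InfPath

end InfinitePaths

section PathModule

variable {V : Type u} [Quiver.{v} V] {K : Type w} [Field K]

variable (V K) in
/-- The path module: the vector space with basis the pairs of an infinite path and an integer, the
degree. The degree records by how much arrows and ghost arrows have shifted a path, so that a
periodic path differs from its own tails. -/
abbrev PathModule : Type (max u v w) := (InfPath V × ℤ) →₀ K

open Classical in
/-- The right action of the generators on the basis of the path module: vertices act as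
projections, an arrow is removed from the front, a ghost arrow is put in front. -/
noncomputable def genActBasis : Gen V → InfPath V × ℤ → PathModule V K
  | .vertex a, x => if x.1.source = a then .single x 1 else 0
  | .arrow e, x => if x.1.head = e then .single (x.1.tail, x.2 - 1) 1 else 0
  | .ghost e, x => if h : e.right = x.1.source then .single (x.1.cons e h, x.2 + 1) 1 else 0

/-- The right action of the free algebra on the path module. It is a homomorphism to the opposite
of the endomorphism algebra because endomorphisms compose from right to left. -/
noncomputable def freeAct : FreeAlg K V →ₙₐ[K] (Module.End K (PathModule V K))ᵐᵒᵖ :=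
  MonoidAlgebra.liftMagma K (FreeSemigroup.lift fun g =>
    MulOpposite.op (Finsupp.linearCombination K (genActBasis g)))

theorem freeAct_single_of (g : Gen V) :
    freeAct (MonoidAlgebra.single (FreeSemigroup.of g) (1 : K)) =
      .op (Finsupp.linearCombination K (genActBasis g)) := by
  simp [freeAct]

open Classical in
theorem freeAct_fVertex_single (a : V) (x : InfPath V) (n : ℤ) (k : K) :
    (freeAct (fVertex K a)).unop (Finsupp.single (x, n) k) =
      if x.source = a then Finsupp.single (x, n) k else 0 := by
  simp [fVertex, freeAct_single_of, genActBasis]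

open Classical in
theorem freeAct_fArrow_single (e : Quiver.Total V) (x : InfPath V) (n : ℤ) (k : K) :
    (freeAct (fArrow K e)).unop (Finsupp.single (x, n) k) =
      if x.head = e then Finsupp.single (x.tail, n - 1) k else 0 := by
  simp [fArrow, freeAct_single_of, genActBasis]

open Classical in
theorem freeAct_fGhost_single (e : Quiver.Total V) (x : InfPath V) (n : ℤ) (k : K) :
    (freeAct (fGhost K e)).unop (Finsupp.single (x, n) k) =
      if h : e.right = x.source then Finsupp.single (x.cons e h, n + 1) k else 0 := by
  simp [fGhost, freeAct_single_of, genActBasis, smul_dite]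

open Classical in
theorem freeAct_fArrow_mul_fGhost_single (e : Quiver.Total V) (x : InfPath V) (n : ℤ) (k : K) :
    (freeAct (fArrow K e * fGhost K e)).unop (Finsupp.single (x, n) k) =
      if x.head = e then Finsupp.single (x, n) k else 0 := by
  rw [map_mul, MulOpposite.unop_mul, Module.End.mul_apply, freeAct_fArrow_single]
  split_ifs with h
  · subst h
    rw [freeAct_fGhost_single, dif_pos x.right_head, x.cons_head_tail, sub_add_cancel]
  · exact map_zero _

theorem starArrow_eq_iff {a : V} {p : Quiver.Star a} {e : Quiver.Total V} (he : e.left = a) :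
    starArrow p = e ↔ p = ⟨e.right, e.hom.cast he rfl⟩ := by
  subst he
  obtain ⟨b, f⟩ := p
  obtain ⟨a, c, e⟩ := e
  simp [starArrow]

theorem freeAct_fVertex_eq_sum (a : V) [Fintype (Quiver.Star a)] :
    freeAct (fVertex K a) =
      freeAct (∑ p : Quiver.Star a, fArrow K (starArrow p) * fGhost K (starArrow p)) := by
  classical
  apply MulOpposite.unop_injective
  refine Finsupp.lhom_ext fun ⟨x, n⟩ k => ?_
  simp only [map_sum, Finset.unop_sum, LinearMap.sum_apply, freeAct_fArrow_mul_fGhost_single,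
    freeAct_fVertex_single]
  split_ifs with hx
  · simp only [eq_comm (a := x.head), starArrow_eq_iff hx, Finset.sum_ite_eq',
      Finset.mem_univ, if_true]
  · refine (Finset.sum_eq_zero fun p _ => if_neg fun hp => hx ?_).symm
    rw [InfPath.source, hp]
    rfl

theorem freeAct_eq_of_rel ⦃x y : FreeAlg K V⦄ (h : Rel K V x y) : freeAct x = freeAct y := by
  classical
  cases h with
  | ck2 a => exact freeAct_fVertex_eq_sum a
  | _ =>
    apply MulOpposite.unop_injective
    refine Finsupp.lhom_ext fun ⟨x, n⟩ k => ?_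
    simp only [map_mul, map_zero, MulOpposite.unop_mul, MulOpposite.unop_zero,
      Module.End.mul_apply, LinearMap.zero_apply, freeAct_fVertex_single, freeAct_fArrow_single,
      freeAct_fGhost_single]
    have htail := x.right_head
    split_ifs <;>
      simp_all [InfPath.source, freeAct_fVertex_single, freeAct_fArrow_single,
        freeAct_fGhost_single]

variable (V K) in
/-- The right action of the Leavitt path algebra on the path module, as a homomorphism. -/
noncomputable def pathAct :
    LeavittPathAlgebra K V →ₙₐ[K] (Module.End K (PathModule V K))ᵐᵒᵖ :=
  leavittLift freeAct freeAct_eq_of_rel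

/-- The endomorphism of the path module by which an element of the Leavitt path algebra acts from
the right. -/
noncomputable def act : LeavittPathAlgebra K V →ₗ[K] Module.End K (PathModule V K) :=
  (MulOpposite.opLinearEquiv K).symm.toLinearMap ∘ₗ
    (pathAct V K : LeavittPathAlgebra K V →ₗ[K] (Module.End K (PathModule V K))ᵐᵒᵖ)

theorem act_mul (x y : LeavittPathAlgebra K V) (f : PathModule V K) :
    act (x * y) f = act y (act x f) := by
  rw [act, LinearMap.comp_apply, LinearMap.coe_coe, map_mul]
  rfl

theorem mem_ker_pathAct {x : LeavittPathAlgebra K V} :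
    x ∈ TwoSidedIdeal.ker (pathAct V K) ↔ act x = 0 := by
  rw [TwoSidedIdeal.mem_ker, ← MulOpposite.unop_eq_zero_iff]
  rfl

open Classical in
theorem act_vertex_single (a : V) (x : InfPath V) (n : ℤ) (k : K) :
    act (vertex K a) (Finsupp.single (x, n) k) =
      if x.source = a then Finsupp.single (x, n) k else 0 :=
  freeAct_fVertex_single a x n k

open Classical in
theorem act_arrow_single (e : Quiver.Total V) (x : InfPath V) (n : ℤ) (k : K) :
    act (arrow K e) (Finsupp.single (x, n) k) =
      if x.head = e then Finsupp.single (x.tail, n - 1) k else 0 :=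
  freeAct_fArrow_single e x n k

theorem vertex_mem_ker_pathAct_of_sink {a : V} (ha : IsEmpty (Quiver.Star a)) :
    vertex K a ∈ TwoSidedIdeal.ker (pathAct V K) := by
  refine mem_ker_pathAct.2 (Finsupp.lhom_ext fun ⟨x, n⟩ k => ?_)
  rw [act_vertex_single, if_neg, LinearMap.zero_apply]
  rintro rfl
  exact ha.elim ⟨_, x.head.hom⟩

end PathModule

section Degree

variable {V : Type u} [Quiver.{v} V] {K : Type w} [Field K]

variable (V K) in
/-- The subspace of the elements of degree at most `n` of the path module. -/
def degreeLE (n : ℤ) : Submodule K (PathModule V K) := Finsupp.supported K K {x | x.2 ≤ n}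

theorem single_mem_degreeLE {m n : ℤ} (h : m ≤ n) (x : InfPath V) (k : K) :
    Finsupp.single (x, m) k ∈ degreeLE V K n :=
  Finsupp.single_mem_supported K k h

theorem degreeLE_mono : Monotone (degreeLE V K) :=
  fun _ _ hmn => Finsupp.supported_mono fun _ hx => le_trans hx hmn

theorem exists_mem_degreeLE (f : PathModule V K) : ∃ n, f ∈ degreeLE V K n :=
  (f.support.image Prod.snd).bddAbove.imp fun _ hn _ hx =>
    hn (Finset.mem_coe.2 (Finset.mem_image_of_mem Prod.snd hx))

theorem eq_zero_of_forall_mem_degreeLE {f : PathModule V K} (h : ∀ n, f ∈ degreeLE V K n) :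
    f = 0 := by
  by_contra hf
  obtain ⟨x, hx⟩ := Finsupp.support_nonempty_iff.2 hf
  exact not_le_of_gt (sub_one_lt x.2) (h (x.2 - 1) hx)

theorem map_mem_degreeLE {φ : Module.End K (PathModule V K)} {d : ℤ}
    (h : ∀ x n, φ (Finsupp.single (x, n) 1) ∈ degreeLE V K (n + d)) {n : ℤ}
    {f : PathModule V K} (hf : f ∈ degreeLE V K n) : φ f ∈ degreeLE V K (n + d) := by
  suffices hle : degreeLE V K n ≤ (degreeLE V K (n + d)).comap φ from hle hf
  rw [degreeLE, Finsupp.supported_eq_span_single, Submodule.span_le]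
  rintro _ ⟨⟨x, m⟩, hm, rfl⟩
  exact degreeLE_mono (add_le_add_left hm d) (h x m)

theorem act_vertex_mem_degreeLE (a : V) {n : ℤ} {f : PathModule V K} (hf : f ∈ degreeLE V K n) :
    act (vertex K a) f ∈ degreeLE V K n := by
  rw [← add_zero n]
  refine map_mem_degreeLE (fun x n => ?_) hf
  rw [act_vertex_single]
  split_ifs
  exacts [single_mem_degreeLE (add_zero n).ge x 1, zero_mem _]

theorem act_arrow_mem_degreeLE (e : Quiver.Total V) {n : ℤ} {f : PathModule V K}
    (hf : f ∈ degreeLE V K n) : act (arrow K e) f ∈ degreeLE V K (n - 1) := by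
  refine map_mem_degreeLE (fun x n => ?_) hf
  rw [act_arrow_single]
  split_ifs
  exacts [single_mem_degreeLE le_rfl _ 1, zero_mem _]

theorem IsWord.act_mem_degreeLE {a : V} {m : ℕ} {x : LeavittPathAlgebra K V}
    (h : IsWord K a m x) {n : ℤ} {f : PathModule V K} (hf : f ∈ degreeLE V K n) :
    act x f ∈ degreeLE V K (n - m) := by
  induction h generalizing n f with
  | nil => simpa only [Nat.cast_zero, sub_zero] using act_vertex_mem_degreeLE a hf
  | cons e _ ih =>
    rw [act_mul, Nat.cast_succ, add_comm, ← sub_sub]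
    exact ih (act_arrow_mem_degreeLE e hf)

theorem act_mem_degreeLE_of_mem_pathSpan {a : V} {m : ℕ} {x : LeavittPathAlgebra K V}
    (hx : x ∈ pathSpan K a (Set.Ici m)) {n : ℤ} {f : PathModule V K}
    (hf : f ∈ degreeLE V K n) : act x f ∈ degreeLE V K (n - m) :=
  pathSpan_le (T := (degreeLE V K (n - m)).comap (act.flip f)) |>.2
    (fun _ hl _ hy => degreeLE_mono (sub_le_sub_left (Nat.cast_le.2 hl) n)
      (hy.act_mem_degreeLE hf)) hx

-- `q` preserves the part of top degree of `f`.
theorem IsPrincipalUnitAt.eq_zero_of_act_eq_zero {a : V} {q : LeavittPathAlgebra K V}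
    (hq : IsPrincipalUnitAt a q) {f : PathModule V K} (hf : act (vertex K a) f = f)
    (h0 : act q f = 0) : f = 0 := by
  have degree_lt (n : ℤ) (hn : f ∈ degreeLE V K n) : f ∈ degreeLE V K (n - 1) := by
    have h := act_mem_degreeLE_of_mem_pathSpan hq hn
    rwa [map_sub, LinearMap.sub_apply, hf, h0, zero_sub, neg_mem_iff, Nat.cast_one] at h
  obtain ⟨N, hN⟩ := exists_mem_degreeLE f
  refine eq_zero_of_forall_mem_degreeLE fun n => ?_
  obtain h | h := le_total N n
  · exact degreeLE_mono h hN
  · exact Int.leInductionDown hN (fun m _ => degree_lt m) n h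

end Degree

section CoefficientSum

variable {V : Type u} [Quiver.{v} V] {K : Type w} [Field K]

variable (K) in
open Classical in
/-- The functional on the path module that adds up the coefficients at the infinite path `x` over
all degrees. -/
noncomputable def coeffSum (x : InfPath V) : PathModule V K →ₗ[K] K :=
  Finsupp.linearCombination K fun y => if y.1 = x then 1 else 0

open Classical in
theorem coeffSum_single (x y : InfPath V) (n : ℤ) (k : K) :
    coeffSum K x (Finsupp.single (y, n) k) = if y = x then k else 0 := by
  simp [coeffSum]

theorem coeffSum_act_vertex_source (x : InfPath V) (f : PathModule V K) :
    coeffSum K x (act (vertex K x.source) f) = coeffSum K x f := by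
  suffices coeffSum K x ∘ₗ act (vertex K x.source) = coeffSum K x from LinearMap.congr_fun this f
  refine Finsupp.lhom_ext fun ⟨y, n⟩ k => ?_
  rw [LinearMap.comp_apply, act_vertex_single, coeffSum_single]
  split_ifs with hsource hyx hyx
  · rw [coeffSum_single, if_pos hyx]
  · rw [coeffSum_single, if_neg hyx]
  · exact absurd (congrArg InfPath.source hyx) hsource
  · exact map_zero _

theorem coeffSum_tail_act_arrow_head (x : InfPath V) (f : PathModule V K) :
    coeffSum K x.tail (act (arrow K x.head) f) = coeffSum K x f := by
  suffices coeffSum K x.tail ∘ₗ act (arrow K x.head) = coeffSum K x from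
    LinearMap.congr_fun this f
  refine Finsupp.lhom_ext fun ⟨y, n⟩ k => ?_
  rw [LinearMap.comp_apply, act_arrow_single, coeffSum_single]
  split_ifs with hhead hyx hyx
  · rw [coeffSum_single, if_pos (congrArg InfPath.tail hyx)]
  · rw [coeffSum_single, if_neg fun htail => hyx (InfPath.ext_head_tail hhead htail)]
  · exact absurd (congrArg InfPath.head hyx) hhead
  · exact map_zero _

variable (K) in
/-- The product of the first `n` arrows of an infinite path, as an element of the Leavitt path
algebra. -/
noncomputable def InfPath.word : ℕ → InfPath V → LeavittPathAlgebra K V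
  | 0, x => vertex K x.source
  | n + 1, x => arrow K x.head * word n x.tail

theorem InfPath.isWord_word (n : ℕ) (x : InfPath V) :
    IsWord K (tail^[n] x).source n (word K n x) := by
  induction n generalizing x with
  | zero => exact .nil
  | succ n ih => exact .cons _ (ih x.tail)

theorem coeffSum_tail_iterate_act_word (n : ℕ) (x : InfPath V) (f : PathModule V K) :
    coeffSum K (InfPath.tail^[n] x) (act (x.word K n) f) = coeffSum K x f := by
  induction n generalizing x f with
  | zero => exact coeffSum_act_vertex_source x f
  | succ n ih =>
    rw [InfPath.word, act_mul, Function.iterate_succ_apply, ih, coeffSum_tail_act_arrow_head]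

theorem act_word_single (n : ℕ) (x : InfPath V) (d : ℤ) (k : K) :
    act (x.word K n) (Finsupp.single (x, d) k) =
      Finsupp.single (InfPath.tail^[n] x, d - n) k := by
  induction n generalizing x d with
  | zero => rw [InfPath.word, act_vertex_single, if_pos rfl, Nat.cast_zero, sub_zero]; rfl
  | succ n ih =>
    rw [InfPath.word, act_mul, act_arrow_single, if_pos rfl, ih, Function.iterate_succ_apply,
      Nat.cast_succ, add_comm, sub_sub]

end CoefficientSum

section MinimalElements

variable {K : Type w} [Field K] {V : Type u} [Quiver.{v} V]
  {I : TwoSidedIdeal (LeavittPathAlgebra K V)}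

theorem exists_infPath_source_eq_of_vertex_notMem (hrow : RowFinite V)
    (hsink : ∀ a : V, IsEmpty (Quiver.Star a) → vertex K a ∈ I) {a : V} (ha : vertex K a ∉ I) :
    ∃ x : InfPath V, x.source = a := by
  obtain ⟨f, hf0, hf⟩ := exists_seq_of_forall_exists_hom
    ((isSaturated_vertex_mem I).exists_hom_remove hrow hsink) ⟨a, ha⟩
  obtain ⟨x, hx⟩ := InfPath.exists_source_eq_of_forall_hom (f := fun n => (f n).1) hf
  exact ⟨x, by rw [hx, hf0]⟩

theorem IsPrincipalUnitAt.notMem (hle : I ≤ TwoSidedIdeal.ker (pathAct V K)) {x : InfPath V}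
    {q : LeavittPathAlgebra K V} (hq : IsPrincipalUnitAt x.source q) : q ∉ I := by
  intro hqI
  have hf : act (vertex K x.source) (Finsupp.single (x, 0) 1) = Finsupp.single (x, 0) 1 := by
    rw [act_vertex_single, if_pos rfl]
  have h0 : act q (Finsupp.single (x, 0) 1) = 0 := by
    rw [mem_ker_pathAct.1 (hle hqI), LinearMap.zero_apply]
  exact one_ne_zero (Finsupp.single_eq_zero.1 (hq.eq_zero_of_act_eq_zero hf h0))

theorem IsMinimalModulo.exists_isPrincipalUnitAt (hrow : RowFinite V)
    (hsink : ∀ a : V, IsEmpty (Quiver.Star a) → vertex K a ∈ I)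
    (hle : I ≤ TwoSidedIdeal.ker (pathAct V K)) {b : LeavittPathAlgebra K V}
    (hb : IsMinimalModulo I b) :
    ∃ (x : InfPath V) (q : LeavittPathAlgebra K V),
      IsPrincipalUnitAt x.source q ∧ IsMinimalModulo I q := by
  obtain ⟨N, hN⟩ := exists_mul_mem_pathSpan_Ici b
  obtain ⟨a, p, hp, hbp⟩ := exists_isWord_mul_notMem hrow hsink N hb.1
  have hmem : b * p ∈ pathSpan K a Set.univ :=
    pathSpan_mono a (Set.subset_univ _) (hN a 0 p (hp.mem_pathSpan (Nat.zero_add N).le))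
  obtain ⟨y, hq⟩ := exists_mul_isPrincipalUnitAt hmem hbp
  have ha : vertex K a ∉ I := by
    intro ha
    rw [← hp.mul_vertex] at hbp
    exact hbp (I.mul_mem_left _ _ (I.mul_mem_left _ _ ha))
  obtain ⟨x, rfl⟩ := exists_infPath_source_eq_of_vertex_notMem hrow hsink ha
  exact ⟨x, _, hq, (hb.mul_right hbp).mul_left (hq.notMem hle)⟩

theorem IsMinimalModulo.exists_isPrincipalUnitAt_tail
    (hle : I ≤ TwoSidedIdeal.ker (pathAct V K)) {x : InfPath V} {q : LeavittPathAlgebra K V}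
    (hq : IsPrincipalUnitAt x.source q) (hmin : IsMinimalModulo I q) :
    ∃ q', IsPrincipalUnitAt x.tail.source q' ∧ IsMinimalModulo I q' := by
  have hq' : IsPrincipalUnitAt x.tail.source (ghost K x.head * (q * arrow K x.head)) := by
    rw [← x.right_head]
    exact IsPrincipalUnitAt.ghost_mul_mul_arrow hq
  have hqI := hq'.notMem hle
  have harrow : q * arrow K x.head ∉ I := fun h => hqI (I.mul_mem_left _ _ h)
  exact ⟨_, hq', (hmin.mul_right harrow).mul_left hqI⟩

theorem IsMinimalModulo.exists_isPrincipalUnitAt_tail_iterate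
    (hle : I ≤ TwoSidedIdeal.ker (pathAct V K)) (n : ℕ) {x : InfPath V}
    {q : LeavittPathAlgebra K V} (hq : IsPrincipalUnitAt x.source q)
    (hmin : IsMinimalModulo I q) :
    ∃ q', IsPrincipalUnitAt (InfPath.tail^[n] x).source q' ∧ IsMinimalModulo I q' := by
  induction n generalizing x q with
  | zero => exact ⟨q, hq, hmin⟩
  | succ n ih =>
    obtain ⟨q', hq', hmin'⟩ := hmin.exists_isPrincipalUnitAt_tail hle hq
    exact ih hq' hmin'

theorem vertex_sub_word_mul_vertex {y : InfPath V} {m : ℕ}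
    (hy : Function.IsPeriodicPt InfPath.tail m y) :
    (vertex K y.source - y.word K m) * vertex K y.source = vertex K y.source - y.word K m := by
  have hword := y.isWord_word (K := K) m
  rw [hy.eq] at hword
  rw [sub_mul, vertex_mul_self, hword.mul_vertex]

theorem coeffSum_act_vertex_sub_word {y : InfPath V} {m : ℕ}
    (hy : Function.IsPeriodicPt InfPath.tail m y) (f : PathModule V K) :
    coeffSum K y (act (vertex K y.source - y.word K m) f) = 0 := by
  have hword := coeffSum_tail_iterate_act_word m y f
  rw [hy.eq] at hword
  rw [map_sub, LinearMap.sub_apply, map_sub, coeffSum_act_vertex_source, hword, sub_self]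

theorem act_vertex_sub_word_single_ne_zero (y : InfPath V) {m : ℕ} (hm : 0 < m) :
    act (vertex K y.source - y.word K m) (Finsupp.single (y, 0) 1) ≠ 0 := by
  rw [map_sub, LinearMap.sub_apply, act_vertex_single, if_pos rfl, act_word_single, sub_ne_zero]
  intro h
  have hdeg := congrArg Prod.snd (Finsupp.single_left_injective one_ne_zero h)
  exact hm.ne' (by simpa using hdeg)

-- Let `c` be the closed path that `y` repeats. As `q` acts injectively,
-- `t * ((y.source - c) * q) = q` modulo `I` would put every path at `y.source` into the image of
-- `y.source - c`, but this image lies in the kernel of the coefficient sum at `y`.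
theorem IsPrincipalUnitAt.not_isMinimalModulo (hle : I ≤ TwoSidedIdeal.ker (pathAct V K))
    {y : InfPath V} (hy : y ∈ Function.periodicPts InfPath.tail) {q : LeavittPathAlgebra K V}
    (hq : IsPrincipalUnitAt y.source q) : ¬ IsMinimalModulo I q := by
  intro hmin
  obtain ⟨m, hm, hper⟩ := hy
  let r := vertex K y.source - y.word K m
  let f : PathModule V K := Finsupp.single (y, 0) 1
  have act_vertex_act (g : PathModule V K) : act (vertex K y.source) (act r g) = act r g := by
    rw [← act_mul, vertex_sub_word_mul_vertex hper]
  have hrq : r * q ∉ I := by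
    intro h
    refine act_vertex_sub_word_single_ne_zero y hm
      (hq.eq_zero_of_act_eq_zero (act_vertex_act f) ?_)
    rw [← act_mul, mem_ker_pathAct.1 (hle h), LinearMap.zero_apply]
  obtain ⟨t, ht⟩ := hmin.2 r hrq
  have act_eq : act r (act t f) - f = 0 := by
    refine hq.eq_zero_of_act_eq_zero ?_ ?_
    · rw [map_sub, act_vertex_act, act_vertex_single, if_pos rfl]
    · have h := LinearMap.congr_fun (mem_ker_pathAct.1 (hle ht)) f
      rwa [map_sub, LinearMap.sub_apply, act_mul, act_mul, ← map_sub] at h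
  have one_eq_zero : (1 : K) = 0 :=
    calc (1 : K) = coeffSum K y f := by rw [coeffSum_single, if_pos rfl]
      _ = coeffSum K y (act r (act t f)) := by rw [sub_eq_zero.1 act_eq]
      _ = 0 := coeffSum_act_vertex_sub_word hper _
  exact one_ne_zero one_eq_zero

theorem Rayless.not_isMinimalModulo (hV : Rayless V) (hrow : RowFinite V)
    (hsink : ∀ a : V, IsEmpty (Quiver.Star a) → vertex K a ∈ I)
    (hle : I ≤ TwoSidedIdeal.ker (pathAct V K)) (b : LeavittPathAlgebra K V) :
    ¬ IsMinimalModulo I b := by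
  intro hb
  obtain ⟨x, q, hq, hmin⟩ := hb.exists_isPrincipalUnitAt hrow hsink hle
  obtain ⟨i, y, hy, hxy⟩ := x.exists_mem_periodicPts_tail hV
  obtain ⟨q', hq', hmin'⟩ := hmin.exists_isPrincipalUnitAt_tail_iterate hle i hq
  rw [hxy] at hq'
  exact hq'.not_isMinimalModulo hle hy hmin'

theorem Rayless.socle_le_ker_pathAct (hV : Rayless V) (hrow : RowFinite V) :
    socle (LeavittPathAlgebra K V) ≤ TwoSidedIdeal.ker (pathAct V K) :=
  socle_le_of_forall_not_isMinimalModulo exists_mul_eq_self <|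
    hV.not_isMinimalModulo hrow (fun _ => vertex_mem_ker_pathAct_of_sink) le_rfl

theorem Rayless.socleOver_socle (hV : Rayless V) (hrow : RowFinite V) :
    socleOver (socle (LeavittPathAlgebra K V)) = socle (LeavittPathAlgebra K V) :=
  socleOver_eq_self_of_forall_not_isMinimalModulo exists_mul_eq_self <|
    hV.not_isMinimalModulo hrow (fun _ => vertex_mem_socle_of_sink)
      (hV.socle_le_ker_pathAct hrow)

end MinimalElements

end LeavittQuiver

theorem proposition4_general (K : Type*) [Field K] (V : Type*) [Quiver V]
    (hrow : LeavittQuiver.RowFinite V) :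
    (∀ u ∈ LeavittQuiver.linePointsOff (LeavittQuiver.hsClosure (LeavittQuiver.linePoints V)),
      ∃ (w : V) (_ : u ⟶ w),
        w ∉ LeavittQuiver.hsClosure (LeavittQuiver.linePoints V) ∧ w ≠ u) ∧
    (∀ (k : ℕ) (u : Fin (k + 1) → V),
      (∀ i, u i ∉ LeavittQuiver.hsClosure (LeavittQuiver.linePoints V)) →
      (∀ i : Fin k, Nonempty (u i.castSucc ⟶ u i.succ)) →
      u 0 ∈ LeavittQuiver.linePointsOff (LeavittQuiver.hsClosure (LeavittQuiver.linePoints V)) →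
      ∃ w : V, w ∉ Set.range u ∧ w ∉ LeavittQuiver.hsClosure (LeavittQuiver.linePoints V) ∧
        Nonempty (u (Fin.last k) ⟶ w)) ∧
    (LeavittQuiver.Rayless V →
      LeavittQuiver.linePointsOff (LeavittQuiver.hsClosure (LeavittQuiver.linePoints V)) = ∅ ∧
      LeavittQuiver.linePointUnion V = LeavittQuiver.linePointSeries V 1 ∧
      LeavittQuiver.socleSeries (LeavittQuiver.LeavittPathAlgebra K V) 2 =
        LeavittQuiver.socleSeries (LeavittQuiver.LeavittPathAlgebra K V) 1 ∧
      LeavittQuiver.socleSum (LeavittQuiver.LeavittPathAlgebra K V) =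
        LeavittQuiver.socleSeries (LeavittQuiver.LeavittPathAlgebra K V) 1) := by
  refine ⟨fun u hu => ?_, fun k u hu hhom h0 =>
    LeavittQuiver.exists_hom_notMem_range_of_mem_linePointsOff hrow hu hhom h0, fun hV => ?_⟩
  · obtain ⟨a, -, rfl⟩ := id hu
    obtain ⟨w, hw, hwH, ⟨e⟩⟩ := LeavittQuiver.exists_hom_notMem_range_of_mem_linePointsOff hrow
      (u := fun _ : Fin 1 => a.1) (fun _ => a.2) (fun i => i.elim0) hu
    exact ⟨w, e, hwH, fun h => hw ⟨0, h.symm⟩⟩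
  · have hline := hV.linePointsOff_hsClosure_linePoints hrow
    have hsocle := hV.socleOver_socle (K := K) hrow
    refine ⟨hline, LeavittQuiver.linePointUnion_eq_linePointSeries_one V hline, ?_,
      LeavittQuiver.socleSum_eq_socleSeries_one _ hsocle⟩
    rw [LeavittQuiver.socleSeries_two, hsocle, LeavittQuiver.socleSeries_one]

theorem proposition4 (K : Type*) [Field K] (V : Type*) [Quiver V]
    (hrow : LeavittQuiver.RowFinite V) :
    (∀ u ∈ LeavittQuiver.linePointsOff (LeavittQuiver.hsClosure (LeavittQuiver.linePoints V)),
      ∃ (w : V) (_ : u ⟶ w),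
        w ∉ LeavittQuiver.hsClosure (LeavittQuiver.linePoints V) ∧ w ≠ u) ∧
    (∀ (k : ℕ) (u : Fin (k + 1) → V), Function.Injective u →
      (∀ i, u i ∉ LeavittQuiver.hsClosure (LeavittQuiver.linePoints V)) →
      (∀ i : Fin k, Nonempty (u i.castSucc ⟶ u i.succ)) →
      u 0 ∈ LeavittQuiver.linePointsOff (LeavittQuiver.hsClosure (LeavittQuiver.linePoints V)) →
      ∃ w : V, w ∉ Set.range u ∧ w ∉ LeavittQuiver.hsClosure (LeavittQuiver.linePoints V) ∧
        Nonempty (u (Fin.last k) ⟶ w)) ∧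
    (Finite V →
      LeavittQuiver.linePointsOff (LeavittQuiver.hsClosure (LeavittQuiver.linePoints V)) = ∅ ∧
      LeavittQuiver.linePointUnion V = LeavittQuiver.linePointSeries V 1 ∧
      LeavittQuiver.socleSeries (LeavittQuiver.LeavittPathAlgebra K V) 2 =
        LeavittQuiver.socleSeries (LeavittQuiver.LeavittPathAlgebra K V) 1 ∧
      LeavittQuiver.socleSum (LeavittQuiver.LeavittPathAlgebra K V) =
        LeavittQuiver.socleSeries (LeavittQuiver.LeavittPathAlgebra K V) 1) := by
  obtain ⟨h₁, h₂, h₃⟩ := proposition4_general K V hrow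
  exact ⟨h₁, fun k u _ => h₂ k u, fun _ => h₃ LeavittQuiver.rayless_of_finite⟩
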